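/- **Proposition 5.2.** Write $T^*S^5=\{(x,\xi)\in\mathbb R^6\times\mathbb R^6 : \|x\|=1,\ x\cdot\xi=0\}$ and identify it with the complex quadric $Q^5=\{z\in\mathbb C^6:\sum_i z_i^2=1\}$ by the diffeomorphism $\Phi(x,\xi)=\cosh(\|\xi\|)\,x+\sqrt{-1}\,\frac{\sinh\|\xi\|}{\|\xi\|}\,\xi$ (with $\Phi(x,0)=x$). Give it the Stenzel Calabi–Yau structure $(I,\omega,\Omega)$: $I$ is multiplication by $\sqrt{-1}$ on $Q^5\subset\mathbb C^6$; $$\omega=\sqrt{-1}\,\partial\bar\partial\,u(r^2)=\sqrt{-1}\sum_{i,j}\frac{\partial^2 u(r^2)}{\partial z_i\partial\bar z_j}\,dz_i\wedge d\bar z_j\Big|_{Q^5},\qquad r^2=\sum_i z_i\bar z_i,$$ where $u$ is a real function, smooth on a neighbourhood of $[1,\infty)$, such that $U(t)=u(\cosh t)$ satisfies $\frac{d}{dt}\big(U'(t)^5\big)=5a(\sinh t)^4$ for a constant $a>0$; and $\Omega_z(v_1,\dots,v_5)=\lambda\det(z,v_1,\dots,v_5)$ for $v_1,\dots,v_5\in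 T_zQ^5$, where $\lambda\in\mathbb C$ has $|\lambda|^2=2^5a$ (the normalization for which $\frac{\omega^5}{5!}=(-1)^{\frac{5\cdot4}{2}}\big(\frac{\sqrt{-1}}2\big)^5\Omega\wedge\overline\Omega$). The metric is $g(v,w)=\omega(v,Iw)$. A special Lagrangian submanifold is an embedded smooth submanifold $\iota:S\hookrightarrow T^*S^5$ of real dimension $5$ with $\iota^*\omega=0$ which can be oriented so that $\iota^*\Omega=e^{\sqrt{-1}\theta}\,\mathrm{vol}_{\iota^*g}$ for a constant $\theta\in\mathbb R$. Let $$L_1=\Big\{\big({}^t(x_1,0,x_3,0,x_5,0),\,{}^t(0,\xi_2,0,\xi_4,0,\xi_6)\big): x_1^2+x_3^2+x_5^2=1,\ \xi_j\in\mathbb R\Big\},$$ $$L_2=\Big\{\big({}^t(x_1,0,x_3,0,0,0),\,{}^t(0,\xi_2,0,\xi_4,\xi_5,\xi_6)\big): x_1^2+x_3^2=1,\ \xi_j\in\mathbb R\Big\}$$ be the conormal bundles of a totally geodesic $S^2$ and a totally geodesic $S^1$ in $S^5$. Let $H=\{\mathrm{diag}(h,h,h): h\in SO(2)\}\cong U(1)$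 act on $T^*S^5$ by $A\cdot(x,\xi)=(Ax,A\xi)$. Its Lie algebra $\mathfrak h$ is spanned by $\eta=\xi_{12}+\xi_{34}+\xi_{56}$, where $\xi_{ij}=E_{ji}-E_{ij}$ and $E_{ij}$ are the matrix units. Let $\mu:T^*S^5\cong Q^5\to\mathfrak h^*$ be the moment map $\langle\mu(z),X\rangle=u'(r^2)\,(Iz\cdot Xz)$, where $\cdot$ is the real inner product of $\mathbb C^6$. For $c\in\mathfrak h^*$ and $j=1,2$ put $V_c^{(j)}=L_j\cap\mu^{-1}(c)$ and $H\cdot V^{(j)}_c=\{A\cdot p: A\in H,\ p\in V^{(j)}_c\}$. Then: 1. $H\cdot V_c^{(1)}$ is a special Lagrangian submanifold of $T^*S^5$ for every $c\in\mathfrak h^*$ with $V_c^{(1)}\neq\emptyset$. 2. $H\cdot V_c^{(2)}$ is a special Lagrangian submanifold of $T^*S^5$ for every $c\in\mathfrak h^*$ with $V_c^{(2)}\neq\emptyset$. -/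

import Mathlib

open scoped ContDiff

noncomputable section

namespace Stenzel

/-- The Euclidean norm `‖x‖ = √(x ⬝ x)` on `ℝᵐ`. -/
def euclNorm {m : ℕ} (x : Fin m → ℝ) : ℝ := √(x ⬝ᵥ x)

/-- The (co)tangent bundle of the unit sphere,
`T*Sⁿ = {(x, ξ) ∈ ℝⁿ⁺¹ × ℝⁿ⁺¹ | ‖x‖ = 1, x ⬝ ξ = 0}`. -/
def cotangentSphere (n : ℕ) : Set ((Fin (n + 1) → ℝ) × (Fin (n + 1) → ℝ)) :=
  {p | euclNorm p.1 = 1 ∧ p.1 ⬝ᵥ p.2 = 0}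

/-- The complex quadric `Qⁿ = {z ∈ ℂⁿ⁺¹ | ∑ zᵢ² = 1}`. -/
def quadric (n : ℕ) : Set (Fin (n + 1) → ℂ) := {z | ∑ i, z i ^ 2 = 1}

/-- Szőke's map `Φ(x, ξ) = cosh ‖ξ‖ x + √-1 (sinh ‖ξ‖ / ‖ξ‖) ξ`; it restricts to a diffeomorphism
`T*Sⁿ → Qⁿ`.  For `ξ = 0` the second summand is `0`, in agreement with the limit. -/
def szoke {n : ℕ} (p : (Fin (n + 1) → ℝ) × (Fin (n + 1) → ℝ)) : Fin (n + 1) → ℂ := fun i =>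
  ((Real.cosh (euclNorm p.2) * p.1 i : ℝ) : ℂ) +
    Complex.I * ((Real.sinh (euclNorm p.2) / euclNorm p.2 * p.2 i : ℝ) : ℂ)

/-- `r² = ∑ zᵢ z̄ᵢ`. -/
def rSq {m : ℕ} (z : Fin m → ℂ) : ℝ := ∑ i, Complex.normSq (z i)

/-- The canonical real inner product on `ℂᵐ`, `Re ∑ zᵢ w̄ᵢ`. -/
def realInner {m : ℕ} (z w : Fin m → ℂ) : ℝ := (∑ i, z i * star (w i)).re

/-- The Wirtinger derivative `∂F/∂zᵢ = (∂F/∂xᵢ - √-1 ∂F/∂yᵢ) / 2`. -/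
def dz {m : ℕ} (i : Fin m) (F : (Fin m → ℂ) → ℂ) (z : Fin m → ℂ) : ℂ :=
  (1 / 2) * (fderiv ℝ F z (Pi.single i 1) - Complex.I * fderiv ℝ F z (Pi.single i Complex.I))

/-- The Wirtinger derivative `∂F/∂z̄ᵢ = (∂F/∂xᵢ + √-1 ∂F/∂yᵢ) / 2`. -/
def dzbar {m : ℕ} (i : Fin m) (F : (Fin m → ℂ) → ℂ) (z : Fin m → ℂ) : ℂ :=
  (1 / 2) * (fderiv ℝ F z (Pi.single i 1) + Complex.I * fderiv ℝ F z (Pi.single i Complex.I))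

/-- `u` is a Stenzel potential with constant `a > 0`: `u` is smooth around the range `[1, ∞)` of
`r²` on `Qⁿ`, and `U(t) = u(cosh t)` satisfies `d/dt (U'(t))ⁿ = a n (sinh t)ⁿ⁻¹`. -/
structure IsPotential (n : ℕ) (a : ℝ) (u : ℝ → ℝ) : Prop where
  pos : 0 < a
  smooth : ∀ s : ℝ, 1 ≤ s → ContDiffAt ℝ ∞ u s
  ode : ∀ t : ℝ, HasDerivAt (fun s : ℝ => (deriv (fun r : ℝ => u (Real.cosh r)) s) ^ n)
    (a * n * Real.sinh t ^ (n - 1)) t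

/-- The Stenzel Kähler form
`ω = √-1 ∂∂̄ u(r²) = √-1 ∑ᵢⱼ ∂²u(r²)/∂zᵢ∂z̄ⱼ dzᵢ ∧ dz̄ⱼ` at `z`, evaluated on two vectors (the sum
is a real number at the points where `u(r²)` is smooth, so taking the real part only changes its
type). -/
def kahlerForm {m : ℕ} (u : ℝ → ℝ) (z v w : Fin m → ℂ) : ℝ :=
  (Complex.I * ∑ i, ∑ j, dz i (dzbar j (fun y => ((u (rSq y) : ℝ) : ℂ))) z *
    (v i * star (w j) - w i * star (v j))).re

/-- The Kähler metric `g(v, w) = ω(v, I w)`, where the complex structure `I` is multiplication by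
`√-1`; equivalently `ω(v, w) = g(I v, w)`. -/
def kahlerMetric {m : ℕ} (u : ℝ → ℝ) (z v w : Fin m → ℂ) : ℝ :=
  kahlerForm u z v (Complex.I • w)

/-- The holomorphic volume form `Ω` of the Stenzel structure on `Qⁿ`: up to the constant `lam`, the
`SO(n+1, ℂ)`-invariant form `(v₁, …, vₙ) ↦ det (z, v₁, …, vₙ)`, i.e. the contraction of
`dz₁ ∧ ⋯ ∧ dzₙ₊₁` with the transversal field `z`.  For a potential with constant `a`, the relation
`ωⁿ / n! = (-1)^(n(n-1)/2) (√-1/2)ⁿ Ω ∧ Ω̄` holds exactly when `|lam|² = 2ⁿ a`. -/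
def volumeForm {n : ℕ} (lam : ℂ) (z : Fin (n + 1) → ℂ) (v : Fin n → Fin (n + 1) → ℂ) : ℂ :=
  lam * Matrix.det (Matrix.of (Fin.cons z v : Fin (n + 1) → Fin (n + 1) → ℂ))

/-- `ψ : W → S` is a local parametrization of the subset `S ⊆ ℂᵐ` as an embedded `k`-dimensional
smooth real submanifold: `W ⊆ ℝᵏ` is open, `ψ` is a smooth immersion on `W`, and a homeomorphism
from `W` onto a relatively open subset `S ∩ O` of `S`. -/
structure IsLocalParametrization (k : ℕ) {m : ℕ} (S : Set (Fin m → ℂ))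
    (W : Set (Fin k → ℝ)) (ψ : (Fin k → ℝ) → (Fin m → ℂ)) : Prop where
  isOpen : IsOpen W
  smooth : ContDiffOn ℝ ∞ ψ W
  immersion : ∀ y ∈ W, Function.Injective (fderiv ℝ ψ y)
  embedding : ∃ (O : Set (Fin m → ℂ)) (χ : (Fin m → ℂ) → (Fin k → ℝ)),
    IsOpen O ∧ ψ '' W = S ∩ O ∧ ContinuousOn χ (S ∩ O) ∧ ∀ y ∈ W, χ (ψ y) = y

/-- `S` is an (embedded) Lagrangian submanifold of `Qⁿ` with respect to the Stenzel form:
an `n`-dimensional submanifold, contained in `Qⁿ`, with `ω|_S = 0`. -/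
def IsLagrangian (n : ℕ) (u : ℝ → ℝ) (S : Set (Fin (n + 1) → ℂ)) : Prop :=
  S ⊆ quadric n ∧ ∀ p ∈ S, ∃ (W : Set (Fin n → ℝ)) (ψ : (Fin n → ℝ) → (Fin (n + 1) → ℂ)),
    IsLocalParametrization n S W ψ ∧ p ∈ ψ '' W ∧
      ∀ y ∈ W, ∀ s t : Fin n → ℝ, kahlerForm u (ψ y) (fderiv ℝ ψ y s) (fderiv ℝ ψ y t) = 0

/-- `S` has constant Lagrangian angle `θ`: `S` is covered by local parametrizations `ψ` (which form
an oriented atlas) in which `ι*Ω = e^{√-1 θ} vol`, i.e.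
`Ω(∂₁ψ, …, ∂ₙψ) = e^{√-1 θ} √(det g(∂ᵢψ, ∂ⱼψ))`. -/
def HasPhase (n : ℕ) (u : ℝ → ℝ) (lam : ℂ) (S : Set (Fin (n + 1) → ℂ)) (θ : ℝ) : Prop :=
  ∀ p ∈ S, ∃ (W : Set (Fin n → ℝ)) (ψ : (Fin n → ℝ) → (Fin (n + 1) → ℂ)),
    IsLocalParametrization n S W ψ ∧ p ∈ ψ '' W ∧
      ∀ y ∈ W, volumeForm lam (ψ y) (fun i => fderiv ℝ ψ y (Pi.single i 1)) =
        Complex.exp (Complex.I * θ) *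
          ((√(Matrix.det (Matrix.of fun i j : Fin n => kahlerMetric u (ψ y)
            (fderiv ℝ ψ y (Pi.single i 1)) (fderiv ℝ ψ y (Pi.single j 1)))) : ℝ) : ℂ)

/-- A subset of `T*Sⁿ` is a special Lagrangian submanifold for the Stenzel structure transported
to `T*Sⁿ` along `Φ` if its image in `Qⁿ` is Lagrangian with constant Lagrangian angle. -/
def IsSpecialLagrangian (n : ℕ) (u : ℝ → ℝ) (lam : ℂ)
    (S : Set ((Fin (n + 1) → ℝ) × (Fin (n + 1) → ℝ))) : Prop :=
  S ⊆ cotangentSphere n ∧ IsLagrangian n u (szoke '' S) ∧ ∃ θ : ℝ, HasPhase n u lam (szoke '' S) θ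

/-- `L₁`, the conormal bundle of `S² ⊆ S⁵` (coordinates `1, 3, 5`) in `T*S⁵`. -/
def L₁ : Set ((Fin 6 → ℝ) × (Fin 6 → ℝ)) :=
  {p | ∃ x₁ x₃ x₅ ξ₂ ξ₄ ξ₆ : ℝ, x₁ ^ 2 + x₃ ^ 2 + x₅ ^ 2 = 1 ∧
    p = (![x₁, 0, x₃, 0, x₅, 0], ![0, ξ₂, 0, ξ₄, 0, ξ₆])}

/-- `L₂`, the conormal bundle of `S¹ ⊆ S⁵` (coordinates `1, 3`) in `T*S⁵`. -/
def L₂ : Set ((Fin 6 → ℝ) × (Fin 6 → ℝ)) :=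
  {p | ∃ x₁ x₃ ξ₂ ξ₄ ξ₅ ξ₆ : ℝ, x₁ ^ 2 + x₃ ^ 2 = 1 ∧
    p = (![x₁, 0, x₃, 0, 0, 0], ![0, ξ₂, 0, ξ₄, ξ₅, ξ₆])}

/-- The block-diagonal matrix `diag(h, h, h)`. -/
def blockDiag (h : Matrix (Fin 2) (Fin 2) ℝ) : Matrix (Fin 6) (Fin 6) ℝ :=
  !![h 0 0, h 0 1, 0, 0, 0, 0;
     h 1 0, h 1 1, 0, 0, 0, 0;
     0, 0, h 0 0, h 0 1, 0, 0;
     0, 0, h 1 0, h 1 1, 0, 0;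
     0, 0, 0, 0, h 0 0, h 0 1;
     0, 0, 0, 0, h 1 0, h 1 1]

/-- The diagonal (Hopf) circle group `H = {diag(h, h, h) | h ∈ SO(2)}`. -/
def hopfGroup : Set (Matrix (Fin 6) (Fin 6) ℝ) :=
  {A | ∃ h ∈ Matrix.specialOrthogonalGroup (Fin 2) ℝ, A = blockDiag h}

/-- `H · V = {(h x, h ξ) | h ∈ H, (x, ξ) ∈ V}`. -/
def hopfOrbit (V : Set ((Fin 6 → ℝ) × (Fin 6 → ℝ))) : Set ((Fin 6 → ℝ) × (Fin 6 → ℝ)) :=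
  {q | ∃ A ∈ hopfGroup, ∃ p ∈ V, q = (A.mulVec p.1, A.mulVec p.2)}

/-- `ξᵢⱼ = Eⱼᵢ - Eᵢⱼ`. -/
def xi (i j : Fin 6) : Matrix (Fin 6) (Fin 6) ℝ := Matrix.single j i 1 - Matrix.single i j 1

/-- The Lie algebra `𝔥 = span {ξ₁₂ + ξ₃₄ + ξ₅₆}` of `H` (indices start at `0` here). -/
def hopfLieAlgebra : Submodule ℝ (Matrix (Fin 6) (Fin 6) ℝ) :=
  Submodule.span ℝ {xi 0 1 + xi 2 3 + xi 4 5}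

/-- The moment map `μ : Qⁿ → 𝔥*`, `⟨μ(z), X⟩ = u'(r²) (I z ⬝ X z)`. -/
def momentMap (u : ℝ → ℝ) (z : Fin 6 → ℂ) : Module.Dual ℝ hopfLieAlgebra where
  toFun X := deriv u (rSq z) *
    realInner (Complex.I • z) (((X : Matrix (Fin 6) (Fin 6) ℝ).map Complex.ofReal).mulVec z)
  map_add' X Y := by
    simp only [realInner, Matrix.mulVec, dotProduct, Submodule.coe_add, Matrix.map_apply,
      Matrix.add_apply, Complex.ofReal_add, add_mul, Finset.sum_add_distrib, star_add, mul_add,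
      Complex.add_re]
  map_smul' t X := by
    simp only [realInner, Matrix.mulVec, dotProduct, Submodule.coe_smul, Matrix.map_apply,
      Matrix.smul_apply, smul_eq_mul, Complex.ofReal_mul, RingHom.id_apply, mul_assoc,
      ← Finset.mul_sum, star_mul', Complex.star_def, Complex.conj_ofReal]
    simp only [mul_left_comm _ (t : ℂ), ← Finset.mul_sum, Complex.re_ofReal_mul]
    ring

/-- `V_c = L ∩ μ⁻¹(c)`, with `μ` read on `T*S⁵` through `Φ`. -/
def levelSet (u : ℝ → ℝ) (L : Set ((Fin 6 → ℝ) × (Fin 6 → ℝ)))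
    (c : Module.Dual ℝ hopfLieAlgebra) : Set ((Fin 6 → ℝ) × (Fin 6 → ℝ)) :=
  {p | p ∈ L ∧ momentMap u (szoke p) = c}

end Stenzel

end

noncomputable section

namespace Stenzel

/-! ### The potential -/

/-! Number the coordinates from `0` and put `x₀, x₁ = z₀ ± √-1 z₁`, `x₂, x₃ = z₂ ± √-1 z₃`. For `L₁`
treat `z₄, z₅` in the same way; for `L₂` put `z₄ = √-1 x₄`, `z₅ = √-1 x₅`. In these coordinates
`Φ(L_j)` is the set of real points of the quadric `x₀x₁ + Q(x₂, …, x₅) = 1`, with `Q = x₂x₃ + x₄x₅`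
or `Q = x₂x₃ - x₄² - x₅²`. The circle multiplies `x_l` by `e^{√-1 n_l φ}` with `n_l = ±1`, except
that for `L₂` it turns `(x₄, x₅)` by a real rotation. That rotation preserves the real points, and
`x₄, x₅` do not enter the moment map there, so it may be dropped: these coordinates get weight `0`.

Hence `Φ(H · V_c)` consists of the points `(ζ^{n_l} v_l)` with `v` real, `|ζ| = 1`, on the quadric
and on a level of the moment map. Allowing every `ζ ≠ 0` gives the same set, because `|ζ|^{n_l} v_l`
is again real. Where `x₀ ≠ 0` one can then normalize `v = (1, 1 - Q(y), y)` and `ζ = e^{t + √-1 φ}`.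
The `t`-derivative of the moment map is twice the Levi form of `u(r²)` on the generator, which is
positive, so the level is a smooth graph `t = T(y)` and `(φ, y)` is a chart
(`AdaptedFrame.exists_chart`). Even permutations of the coordinates bring every other point to this
case.

The chart is Lagrangian: up to the linear isomorphism `vec σ`, its tangent vectors are real vectors
plus `√-1` times real multiples of the generator. The Levi form is real on real vectors, and its
cross terms are derivatives of the moment map along its level, hence zero. The weights sum to `0`,
so `det (z, ∂ψ)` reduces to a real determinant that equals `-2` by homogeneity and invariance of `Q`
(`det_slice`). Thus `Ω(∂ψ)` is the same constant in every chart. On Lagrangian frames the Calabi–Yau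
identity `normSq_volumeForm` identifies `|Ω|` with the Riemannian volume, so the Lagrangian angle is
constant. -/

theorem IsPotential.hasDerivAt {n : ℕ} {a : ℝ} {u : ℝ → ℝ} (hu : IsPotential n a u) {s : ℝ}
    (hs : 1 ≤ s) : HasDerivAt u (deriv u s) s :=
  ((hu.smooth s hs).differentiableAt (by simp)).hasDerivAt

theorem contDiffAt_deriv {f : ℝ → ℝ} {s : ℝ} (hf : ContDiffAt ℝ ∞ f s) :
    ContDiffAt ℝ ∞ (deriv f) s := by
  have h : ContDiffAt ℝ ∞ (fun x => fderiv ℝ f x 1) s :=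
    (hf.fderiv_right (m := ∞) (by simp)).clm_apply contDiffAt_const
  simpa using h

theorem IsPotential.contDiffAt_deriv {n : ℕ} {a : ℝ} {u : ℝ → ℝ} (hu : IsPotential n a u) {s : ℝ}
    (hs : 1 ≤ s) : ContDiffAt ℝ ∞ (deriv u) s :=
  Stenzel.contDiffAt_deriv (hu.smooth s hs)

theorem IsPotential.hasDerivAt_deriv {n : ℕ} {a : ℝ} {u : ℝ → ℝ} (hu : IsPotential n a u) {s : ℝ}
    (hs : 1 ≤ s) : HasDerivAt (deriv u) (deriv (deriv u) s) s :=
  ((hu.contDiffAt_deriv hs).differentiableAt (by simp)).hasDerivAt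

/-- This is the Monge–Ampère equation in radial form: `U'(t) = u'(cosh t) sinh t`, and both sides of
the differentiated ODE contain the factor `5 sinh⁴ t`, which can be cancelled away from `t = 0`. -/
theorem IsPotential.identity_cosh {a : ℝ} {u : ℝ → ℝ} (hu : IsPotential 5 a u) (t : ℝ)
    (ht : t ≠ 0) :
    deriv u (Real.cosh t) ^ 4 * (deriv u (Real.cosh t) * Real.cosh t +
      deriv (deriv u) (Real.cosh t) * (Real.cosh t ^ 2 - 1)) = a := by
  have h1 : (deriv fun r : ℝ => u (Real.cosh r)) = fun r => deriv u (Real.cosh r) * Real.sinh r := by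
    funext r
    exact ((hu.hasDerivAt (Real.one_le_cosh r)).comp r (Real.hasDerivAt_cosh r)).deriv
  have h2 := hu.ode t
  rw [h1] at h2
  have h3 := ((((hu.hasDerivAt_deriv (Real.one_le_cosh t)).comp t (Real.hasDerivAt_cosh t)).mul
    (Real.hasDerivAt_sinh t)).pow 5).unique h2
  have hs : Real.sinh t ≠ 0 := by simpa using ht
  have hc := Real.cosh_sq t
  apply mul_left_cancel₀ (mul_ne_zero (by norm_num : (5 : ℝ) ≠ 0) (pow_ne_zero 4 hs))
  simp only [Function.comp, Pi.mul_apply] at h3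
  norm_num at h3
  rw [hc]
  linear_combination h3

theorem IsPotential.identity {a : ℝ} {u : ℝ → ℝ} (hu : IsPotential 5 a u) {s : ℝ} (hs : 1 ≤ s) :
    deriv u s ^ 4 * (deriv u s * s + deriv (deriv u) s * (s ^ 2 - 1)) = a := by
  rcases hs.lt_or_eq with h | h
  · have h0 : Real.cosh (Real.arcosh s) = s := Real.cosh_arcosh hs
    have := hu.identity_cosh (Real.arcosh s) (by
      intro h'; rw [h', Real.cosh_zero] at h0; linarith)
    rwa [h0] at this
  -- At `r² = 1` the cancelled factor vanishes, so the identity is obtained as a limit `t → 0` with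
  -- `t ≠ 0`.
  · subst h
    have hc : ContinuousAt (fun t => deriv u (Real.cosh t) ^ 4 * (deriv u (Real.cosh t) *
        Real.cosh t + deriv (deriv u) (Real.cosh t) * (Real.cosh t ^ 2 - 1))) 0 := by
      have e : Real.cosh 0 = 1 := Real.cosh_zero
      have hk : ContinuousAt Real.cosh 0 := Real.continuous_cosh.continuousAt
      have c1 : ContinuousAt (deriv u) (Real.cosh 0) :=
        (hu.contDiffAt_deriv (by rw [e])).continuousAt
      have c2 : ContinuousAt (deriv (deriv u)) (Real.cosh 0) :=
        (Stenzel.contDiffAt_deriv (hu.contDiffAt_deriv (by rw [e]))).continuousAt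
      have d1 : ContinuousAt (fun t => deriv u (Real.cosh t)) 0 := c1.comp hk
      have d2 : ContinuousAt (fun t => deriv (deriv u) (Real.cosh t)) 0 := c2.comp hk
      fun_prop
    have ht := hc.tendsto.mono_left (nhdsWithin_le_nhds (s := {0}ᶜ))
    have ht2 := tendsto_nhds_unique ht (tendsto_const_nhds.congr' (by
      filter_upwards [self_mem_nhdsWithin] with t ht using (hu.identity_cosh t ht).symm))
    simpa using ht2

/-- The identity forbids zeros of `u'` on `[1, ∞)` and reads `u'(1)⁵ = a > 0` at `1`; the
intermediate value theorem does the rest. -/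
theorem IsPotential.deriv_pos {a : ℝ} {u : ℝ → ℝ} (hu : IsPotential 5 a u) {s : ℝ} (hs : 1 ≤ s) :
    0 < deriv u s := by
  have hne : ∀ t, 1 ≤ t → deriv u t ≠ 0 := fun t ht h0 => by
    have := hu.identity ht
    rw [h0] at this
    have := hu.pos
    simp_all
  have h1 : 0 < deriv u 1 := by
    have := hu.identity le_rfl
    have h : deriv u 1 ^ 5 = a := by linear_combination this
    exact (Odd.pow_pos_iff (by decide)).1 (h ▸ hu.pos)
  by_contra hcon
  have hcont : ContinuousOn (deriv u) (Set.Icc 1 s) := fun t ht =>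
    (hu.contDiffAt_deriv ht.1).continuousAt.continuousWithinAt
  obtain ⟨t, ht, h0⟩ := intermediate_value_Icc' hs hcont ⟨not_lt.1 hcon, h1.le⟩
  exact hne t ht.1 h0

/-! ### The Kähler form -/

/-- The coefficient form of `∂∂̄ u(r²)`: `(v, w) ↦ u' ⟨v, w⟩ + u'' ⟨v, z⟩ ⟨z, w⟩`. -/
def leviForm {m : ℕ} (f f' : ℝ) (z v w : Fin m → ℂ) : ℂ :=
  f * (v ⬝ᵥ star w) + f' * ((v ⬝ᵥ star z) * (z ⬝ᵥ star w))

theorem dotProduct_star_self {m : ℕ} (z : Fin m → ℂ) : z ⬝ᵥ star z = rSq z := by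
  simp [dotProduct, rSq, Complex.mul_conj]

theorem leviForm_conj {m : ℕ} (f f' : ℝ) (z v w : Fin m → ℂ) :
    star (leviForm f f' z v w) = leviForm f f' z w v := by
  have h (v w : Fin m → ℂ) : (starRingEnd ℂ) (v ⬝ᵥ star w) = w ⬝ᵥ star v := by
    simp [dotProduct, mul_comm]
  simp only [leviForm, Complex.star_def, map_add, map_mul, h, Complex.conj_ofReal]
  ring

theorem hasFDerivAt_normSq (w : ℂ) : HasFDerivAt Complex.normSq
    ((2 * w.re) • Complex.reCLM + (2 * w.im) • Complex.imCLM) w := by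
  have h1 := (Complex.reCLM.hasFDerivAt (x := w)).mul (Complex.reCLM.hasFDerivAt (x := w))
  have h2 := (Complex.imCLM.hasFDerivAt (x := w)).mul (Complex.imCLM.hasFDerivAt (x := w))
  refine ((h1.add h2).congr_of_eventuallyEq (.of_forall fun x => ?_)).congr_fderiv ?_
  · simp [Complex.normSq_apply]
  · ext
    all_goals simp
    all_goals ring

theorem hasFDerivAt_rSq {m : ℕ} (z : Fin m → ℂ) : HasFDerivAt rSq
    (∑ i, ((2 * (z i).re) • Complex.reCLM + (2 * (z i).im) • Complex.imCLM).comp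
      (ContinuousLinearMap.proj (R := ℝ) (φ := fun _ : Fin m => ℂ) i)) z := by
  unfold rSq
  exact HasFDerivAt.fun_sum fun i _ => (hasFDerivAt_normSq (z i)).comp z
    (ContinuousLinearMap.proj (R := ℝ) (φ := fun _ : Fin m => ℂ) i).hasFDerivAt

theorem fderiv_rSq_single {m : ℕ} (z : Fin m → ℂ) (i : Fin m) (w : ℂ) :
    fderiv ℝ rSq z (Pi.single i w) = 2 * ((z i).re * w.re + (z i).im * w.im) := by
  rw [(hasFDerivAt_rSq z).fderiv]
  rw [sum_apply, Finset.sum_eq_single i]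
  · simp
    ring
  · intro j _ hj
    simp [hj]
  · simp

theorem dzbar_potential {m : ℕ} {u : ℝ → ℝ} {z : Fin m → ℂ} (j : Fin m)
    (hu : DifferentiableAt ℝ u (rSq z)) :
    dzbar j (fun y => ((u (rSq y) : ℝ) : ℂ)) z = deriv u (rSq z) * z j := by
  have h : HasFDerivAt (fun y : Fin m → ℂ => ((u (rSq y) : ℝ) : ℂ))
      (Complex.ofRealCLM.comp (deriv u (rSq z) • fderiv ℝ rSq z)) z :=
    Complex.ofRealCLM.hasFDerivAt.comp z
      (hu.hasDerivAt.comp_hasFDerivAt z (hasFDerivAt_rSq z).differentiableAt.hasFDerivAt)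
  rw [dzbar, h.fderiv]
  apply Complex.ext <;> simp [fderiv_rSq_single] <;> ring

theorem dz_deriv_mul {m : ℕ} {f : ℝ → ℝ} {z : Fin m → ℂ} (i j : Fin m)
    (hf : DifferentiableAt ℝ f (rSq z)) :
    dz i (fun y => (f (rSq y) : ℂ) * y j) z =
      f (rSq z) * (if i = j then 1 else 0) + deriv f (rSq z) * (star (z i) * z j) := by
  have h : HasFDerivAt (fun y : Fin m → ℂ => ((f (rSq y) : ℝ) : ℂ))
      (Complex.ofRealCLM.comp (deriv f (rSq z) • fderiv ℝ rSq z)) z :=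
    Complex.ofRealCLM.hasFDerivAt.comp z
      (hf.hasDerivAt.comp_hasFDerivAt z (hasFDerivAt_rSq z).differentiableAt.hasFDerivAt)
  have h' := h.mul (ContinuousLinearMap.proj (R := ℝ) (φ := fun _ : Fin m => ℂ) j).hasFDerivAt
  have h'' : HasFDerivAt (fun y : Fin m → ℂ => (f (rSq y) : ℂ) * y j) _ z := h'
  rw [dz, h''.fderiv]
  by_cases hij : i = j
  · subst hij
    apply Complex.ext <;> simp [fderiv_rSq_single] <;> ring
  · have hji : j ≠ i := fun h => hij h.symm
    apply Complex.ext <;> simp [fderiv_rSq_single, hij, hji] <;> ring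

theorem dz_dzbar_potential {n m : ℕ} {a : ℝ} {u : ℝ → ℝ} (hu : IsPotential n a u) {z : Fin m → ℂ}
    (hz : 1 ≤ rSq z) (i j : Fin m) :
    dz i (dzbar j (fun y => ((u (rSq y) : ℝ) : ℂ))) z =
      deriv u (rSq z) * (if i = j then 1 else 0) +
        deriv (deriv u) (rSq z) * (star (z i) * z j) := by
  rw [← dz_deriv_mul i j (hu.hasDerivAt_deriv hz).differentiableAt]
  have hev : ∀ᶠ s in nhds (rSq z), DifferentiableAt ℝ u s := by
    have h1 : ContDiffAt ℝ 1 u (rSq z) := (hu.smooth _ hz).of_le (by simp)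
    filter_upwards [h1.eventually (by simp)] with s hs using hs.differentiableAt (by simp)
  have hev2 : (dzbar j fun y => ((u (rSq y) : ℝ) : ℂ)) =ᶠ[nhds z]
      fun y => ((deriv u (rSq y) : ℝ) : ℂ) * y j := by
    filter_upwards [(hasFDerivAt_rSq z).continuousAt.eventually hev] with y hy
      using dzbar_potential j hy
  rw [dz, dz, hev2.fderiv_eq]

/-- The form is `√-1` times the antisymmetrization of the Levi form, and the latter is Hermitian:
`√-1 (L - L̄) = -2 Im L`. -/
theorem kahlerForm_eq {n m : ℕ} {a : ℝ} {u : ℝ → ℝ} (hu : IsPotential n a u) {z : Fin m → ℂ}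
    (hz : 1 ≤ rSq z) (v w : Fin m → ℂ) :
    kahlerForm u z v w = -2 * (leviForm (deriv u (rSq z)) (deriv (deriv u) (rSq z)) z v w).im := by
  have key (v w : Fin m → ℂ) :
      ∑ i, ∑ j, ((deriv u (rSq z) : ℝ) * (if i = j then 1 else 0) +
        (deriv (deriv u) (rSq z) : ℝ) * (star (z i) * z j)) * (v i * star (w j)) =
      leviForm (deriv u (rSq z)) (deriv (deriv u) (rSq z)) z v w := by
    simp only [leviForm, add_mul, Finset.sum_add_distrib, dotProduct, Finset.mul_sum,
      Finset.sum_mul, Pi.star_apply]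
    congr 1
    · simp
    · rw [Finset.sum_comm]
      refine Finset.sum_congr rfl fun i _ => Finset.sum_congr rfl fun j _ => by ring
  unfold kahlerForm
  simp only [dz_dzbar_potential hu hz, mul_sub, Finset.sum_sub_distrib, key]
  rw [← leviForm_conj _ _ z v w]
  simp
  ring

theorem kahlerMetric_eq {n m : ℕ} {a : ℝ} {u : ℝ → ℝ} (hu : IsPotential n a u) {z : Fin m → ℂ}
    (hz : 1 ≤ rSq z) (v w : Fin m → ℂ) :
    kahlerMetric u z v w = 2 * (leviForm (deriv u (rSq z)) (deriv (deriv u) (rSq z)) z v w).re := by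
  have h : leviForm (deriv u (rSq z)) (deriv (deriv u) (rSq z)) z v (Complex.I • w) =
      -Complex.I * leviForm (deriv u (rSq z)) (deriv (deriv u) (rSq z)) z v w := by
    simp [leviForm]
    ring
  rw [kahlerMetric, kahlerForm_eq hu hz, h]
  simp

theorem one_le_rSq {n : ℕ} {z : Fin (n + 1) → ℂ} (hz : z ∈ quadric n) : 1 ≤ rSq z := by
  have h : ‖∑ i, z i ^ 2‖ = 1 := by rw [show ∑ i, z i ^ 2 = 1 from hz]; simp
  rw [← h]
  refine (norm_sum_le _ _).trans_eq ?_
  simp [rSq, Complex.normSq_eq_norm_sq]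

/-! ### The Calabi–Yau identity -/

/-- By Sylvester's identity `det (1 + AB) = det (1 + BA)` the computation is that of a `2 × 2`
determinant. -/
theorem det_rank_two_update (f : ℂ) (hf : f ≠ 0) (p q r s : Fin 6 → ℂ) :
    Matrix.det (Matrix.of fun i j => f * (if i = j then 1 else 0) + (p i * r j + q i * s j) :
      Matrix (Fin 6) (Fin 6) ℂ) =
      f ^ 4 * ((f + r ⬝ᵥ p) * (f + s ⬝ᵥ q) - (r ⬝ᵥ q) * (s ⬝ᵥ p)) := by
  have h : (Matrix.of fun i j => f * (if i = j then 1 else 0) + (p i * r j + q i * s j) :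
      Matrix (Fin 6) (Fin 6) ℂ) =
      f • (1 + (Matrix.of fun i (k : Fin 2) => f⁻¹ * ![p i, q i] k) * Matrix.of ![r, s]) := by
    ext i j
    simp [Matrix.mul_apply, Fin.sum_univ_two, Matrix.one_apply]
    field_simp
    simp
  rw [h, Matrix.det_smul, Matrix.det_one_add_mul_comm, Matrix.det_fin_two]
  have e (v w : Fin 6 → ℂ) : ∑ i, v i * (f⁻¹ * w i) = f⁻¹ * (v ⬝ᵥ w) := by
    simp only [dotProduct, Finset.mul_sum]
    exact Finset.sum_congr rfl fun _ _ => by ring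
  simp only [Matrix.add_apply, Matrix.one_apply, Matrix.mul_apply, Matrix.of_apply,
    Matrix.cons_val_zero, Matrix.cons_val_one, e]
  simp
  field_simp

/-- The Levi form on a tangent frame is the lower right block of `M K M*`, where `M` has rows `z,
v₁, …, v₅` and `K` is a multiple of the identity plus a rank-two matrix. So `|det (z, v)|²` appears
with the factor `det K`. -/
theorem det_leviForm {f f' : ℝ} (hf : f ≠ 0) {z : Fin 6 → ℂ} (hz : z ∈ quadric 5)
    (v : Fin 5 → Fin 6 → ℂ) (hv : ∀ i, z ⬝ᵥ v i = 0) :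
    Matrix.det (Matrix.of fun i j => leviForm f f' z (v i) (v j)) =
      f ^ 4 * (f * rSq z + f' * (rSq z ^ 2 - 1)) *
        Complex.normSq (Matrix.det (Matrix.of (Fin.cons z v : Fin 6 → Fin 6 → ℂ))) := by
  set M : Matrix (Fin 6) (Fin 6) ℂ := Matrix.of (Fin.cons z v : Fin 6 → Fin 6 → ℂ) with hM
  have hzz : z ⬝ᵥ z = 1 := by
    rw [← show ∑ i, z i ^ 2 = 1 from hz]
    exact Finset.sum_congr rfl fun _ _ => by ring
  have hzz' : star z ⬝ᵥ star z = 1 := by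
    rw [← star_one ℂ, ← hzz, Matrix.star_dotProduct_star]
  have hzs : z ⬝ᵥ star z = (rSq z : ℂ) := dotProduct_star_self z
  have hzs' : star z ⬝ᵥ z = (rSq z : ℂ) := by rw [dotProduct_comm, hzs]
  have hvs (i) : star z ⬝ᵥ star (v i) = 0 := by
    rw [Matrix.star_dotProduct_star, dotProduct_comm, hv, star_zero]
  -- On tangent vectors the `star z` part of `r` is invisible. Its coefficient is chosen to make `r
  -- ⬝ᵥ star z = -f`, which clears the first column of `M K M*` below the corner; the term `z i *
  -- star z j` then makes the corner equal to `1`.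
  set r : Fin 6 → ℂ := (f' : ℂ) • z - ((f : ℂ) + f' * rSq z) • star z with hr
  set K : Matrix (Fin 6) (Fin 6) ℂ :=
    Matrix.of fun i j => (f : ℂ) * (if i = j then 1 else 0) + (star z i * r j + z i * star z j)
    with hK
  have hMK (i j) : (M * K * M.conjTranspose) i j =
      f * (M i ⬝ᵥ star (M j)) + ((M i ⬝ᵥ star z) * (r ⬝ᵥ star (M j)) +
        (M i ⬝ᵥ z) * (star z ⬝ᵥ star (M j))) := by
    have h1 (k) : (M * K) i k = f * M i k + ((M i ⬝ᵥ star z) * r k + (M i ⬝ᵥ z) * star z k) := by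
      simp only [Matrix.mul_apply, hK, Matrix.of_apply, mul_add, Finset.sum_add_distrib, dotProduct,
        Finset.sum_mul]
      congr 1
      · simp [mul_comm]
      · congr 1 <;> exact Finset.sum_congr rfl fun _ _ => by ring
    rw [Matrix.mul_apply]
    simp only [h1, Matrix.conjTranspose_apply, add_mul, Finset.sum_add_distrib, dotProduct,
      Finset.mul_sum, mul_assoc, Pi.star_apply]
  have hrs (w : Fin 6 → ℂ) : r ⬝ᵥ w = f' * (z ⬝ᵥ w) - (f + f' * rSq z) * (star z ⬝ᵥ w) := by
    simp [hr, sub_dotProduct, smul_dotProduct]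
  have hM0 : M 0 = z := rfl
  have hMs (i : Fin 5) : M i.succ = v i := rfl
  have hdetK : K.det = f ^ 4 * (f * rSq z + f' * (rSq z ^ 2 - 1)) := by
    rw [hK, det_rank_two_update _ (by exact_mod_cast hf)]
    simp only [hrs, hzz, hzz', hzs, hzs']
    ring
  have hdet : (M * K * M.conjTranspose).det =
      Matrix.det (Matrix.of fun i j => leviForm f f' z (v i) (v j)) := by
    rw [Matrix.det_succ_column_zero, Fin.sum_univ_succ]
    have hz0 (i : Fin 5) : (M * K * M.conjTranspose) i.succ 0 = 0 := by
      rw [hMK, hM0, hMs, hrs, dotProduct_comm _ z, hv, hzs, hzz']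
      ring
    have h00 : (M * K * M.conjTranspose) 0 0 = 1 := by
      rw [hMK, hM0, hrs, hzz, hzs, hzz']
      ring
    simp only [hz0, h00]
    simp only [Fin.val_zero, pow_zero, mul_zero, zero_mul, Finset.sum_const_zero, add_zero, one_mul]
    congr 1
    ext i j
    simp only [Matrix.submatrix_apply, Fin.succAbove_zero, hMK, hMs, hrs, hvs,
      dotProduct_comm (v i) z, hv, Matrix.of_apply, leviForm]
    ring
  rw [← hdet, Matrix.det_mul, Matrix.det_mul, hdetK, Matrix.det_conjTranspose,
    Complex.star_def, ← Complex.mul_conj]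
  ring

theorem normSq_dotProduct_star_le {m : ℕ} (v w : Fin m → ℂ) :
    Complex.normSq (v ⬝ᵥ star w) ≤ rSq v * rSq w := by
  have h := norm_inner_le_norm (𝕜 := ℂ) (WithLp.toLp 2 w) (WithLp.toLp 2 v)
  rw [EuclideanSpace.inner_eq_star_dotProduct] at h
  have e (v : Fin m → ℂ) : ‖WithLp.toLp 2 v‖ ^ 2 = rSq v := by
    rw [EuclideanSpace.norm_sq_eq]
    simp [rSq, Complex.normSq_eq_norm_sq]
  rw [Complex.normSq_eq_norm_sq, ← e, ← e, ← mul_pow, mul_comm ‖WithLp.toLp 2 v‖]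
  exact pow_le_pow_left₀ (norm_nonneg _) h 2

theorem leviForm_self {m : ℕ} (f f' : ℝ) (z v : Fin m → ℂ) :
    leviForm f f' z v v = ((f * rSq v + f' * Complex.normSq (v ⬝ᵥ star z) : ℝ) : ℂ) := by
  have h : z ⬝ᵥ star v = (starRingEnd ℂ) (v ⬝ᵥ star z) := by simp [dotProduct, mul_comm]
  rw [leviForm, dotProduct_star_self, h, Complex.mul_conj]
  push_cast
  rfl

/-- A tangent vector is Hermitian-orthogonal to `z̄`, so in `⟨v, z⟩` only the part of `z` orthogonal
to `z̄` counts. Cauchy–Schwarz for that part is exactly strong enough for the radial Monge–Ampère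
expression to control a negative `u''`. -/
theorem leviForm_self_pos {a : ℝ} {u : ℝ → ℝ} (hu : IsPotential 5 a u) {z : Fin 6 → ℂ}
    (hz : z ∈ quadric 5) {v : Fin 6 → ℂ} (hv : z ⬝ᵥ v = 0) (hv0 : v ≠ 0) :
    0 < deriv u (rSq z) * rSq v +
      deriv (deriv u) (rSq z) * Complex.normSq (v ⬝ᵥ star z) := by
  have hs := one_le_rSq hz
  have hf := hu.deriv_pos hs
  have hid := hu.identity hs
  set s := rSq z
  set f := deriv u s
  set f' := deriv (deriv u) s
  have hpos : 0 < f * s + f' * (s ^ 2 - 1) := by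
    have := hu.pos
    rw [← hid] at this
    exact pos_of_mul_pos_right this (by positivity)
  have hv1 : 0 < rSq v := by
    obtain ⟨i, hi⟩ := Function.ne_iff.1 hv0
    exact Finset.sum_pos' (fun i _ => Complex.normSq_nonneg _)
      ⟨i, Finset.mem_univ i, Complex.normSq_pos.2 hi⟩
  have hzz : z ⬝ᵥ z = 1 := by
    rw [← show ∑ i, z i ^ 2 = 1 from hz]
    exact Finset.sum_congr rfl fun _ _ => by ring
  have hzz' : star z ⬝ᵥ star z = 1 := by
    rw [← star_one ℂ, ← hzz, Matrix.star_dotProduct_star]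
  have hcs : s * Complex.normSq (v ⬝ᵥ star z) ≤ (s ^ 2 - 1) * rSq v := by
    have hs0 : (s : ℂ) ≠ 0 := by exact_mod_cast (by linarith : s ≠ 0)
    -- `z - s⁻¹ z̄` is the component of `z` orthogonal to `z̄`, since `⟨z, z̄⟩ = ∑ zᵢ² = 1` and
    -- `|z̄|² = s`; its square length is `s - s⁻¹`.
    have h1 := normSq_dotProduct_star_le v (z - (s : ℂ)⁻¹ • star z)
    have h2 : v ⬝ᵥ star (z - (s : ℂ)⁻¹ • star z) = v ⬝ᵥ star z := by
      simp [dotProduct_sub, dotProduct_smul, dotProduct_comm v z, hv]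
    have h3 : (rSq (z - (s : ℂ)⁻¹ • star z) : ℂ) = s - (s : ℂ)⁻¹ := by
      rw [← dotProduct_star_self]
      have e1 : z ⬝ᵥ star z = (s : ℂ) := dotProduct_star_self z
      have e2 : star z ⬝ᵥ z = (s : ℂ) := by rw [dotProduct_comm, e1]
      simp [dotProduct_sub, sub_dotProduct, dotProduct_smul, smul_dotProduct, e1, e2, hzz, hzz']
      rw [inv_mul_cancel₀ hs0]
      simp
    have h4 : rSq (z - (s : ℂ)⁻¹ • star z) = s - s⁻¹ := by exact_mod_cast h3
    rw [h2, h4] at h1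
    have h5 := mul_le_mul_of_nonneg_left h1 (by linarith : 0 ≤ s)
    have : s * (rSq v * (s - s⁻¹)) = (s ^ 2 - 1) * rSq v := by field_simp
    linarith
  rcases le_or_gt 0 f' with h | h
  · have := mul_nonneg h (Complex.normSq_nonneg (v ⬝ᵥ star z))
    have := mul_pos hf hv1
    linarith
  · have h1 := mul_le_mul_of_nonpos_left hcs h.le
    have h2 := mul_pos hpos hv1
    have h3 : 0 < s * (f * rSq v + f' * Complex.normSq (v ⬝ᵥ star z)) := by nlinarith
    exact pos_of_mul_pos_right h3 (by linarith)

/-- On a Lagrangian tangent frame the norm of the holomorphic volume form is the Riemannian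
volume. -/
theorem normSq_volumeForm {a : ℝ} {u : ℝ → ℝ} (hu : IsPotential 5 a u) {lam : ℂ}
    (hlam : ‖lam‖ ^ 2 = 2 ^ 5 * a) {z : Fin 6 → ℂ} (hz : z ∈ quadric 5)
    (v : Fin 5 → Fin 6 → ℂ) (hv : ∀ i, z ⬝ᵥ v i = 0)
    (hω : ∀ i j, kahlerForm u z (v i) (v j) = 0) :
    Matrix.det (Matrix.of fun i j => kahlerMetric u z (v i) (v j)) =
      ‖volumeForm lam z v‖ ^ 2 := by
  have hs := one_le_rSq hz
  have h1 : (Matrix.of fun i j => kahlerMetric u z (v i) (v j)).map Complex.ofRealHom =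
      -- The Lagrangian condition makes the Levi matrix real, so twice it is the Gram matrix of the
      -- metric. The scalar contributes `2⁵`, which is why `|λ|² = 2⁵ a`.
      (2 : ℂ) • Matrix.of fun i j =>
        leviForm (deriv u (rSq z)) (deriv (deriv u) (rSq z)) z (v i) (v j) := by
    ext i j
    have h := hω i j
    rw [kahlerForm_eq hu hs] at h
    simp only [Matrix.map_apply, Matrix.of_apply, Matrix.smul_apply, smul_eq_mul,
      kahlerMetric_eq hu hs]
    apply Complex.ext
    · simp
    · simp; linarith
  have h2 := congrArg Matrix.det h1
  rw [← RingHom.mapMatrix_apply, ← RingHom.map_det, Matrix.det_smul,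
    det_leviForm (hu.deriv_pos hs).ne' hz v hv] at h2
  have h3 := hu.identity hs
  have h4 : ((deriv u (rSq z) : ℝ) : ℂ) ^ 4 * (((deriv u (rSq z) : ℝ) : ℂ) * rSq z +
      ((deriv (deriv u) (rSq z) : ℝ) : ℂ) * ((rSq z : ℂ) ^ 2 - 1)) = a := by exact_mod_cast h3
  rw [h4] at h2
  rw [volumeForm, norm_mul, mul_pow, hlam, ← Complex.normSq_eq_norm_sq]
  simp only [Complex.ofRealHom_eq_coe, Fintype.card_fin] at h2
  rw [mul_assoc]
  exact_mod_cast h2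

/-! ### Solutions of an equation that is strictly monotone in its last variable -/

/-- The implicit function theorem gives smooth local solutions; strict monotonicity makes solutions
unique, so the local ones agree with a single function `T` on the open set where a solution exists.
-/
theorem exists_smooth_solution {E : Type*} [NormedAddCommGroup E] [NormedSpace ℝ E]
    [CompleteSpace E] {g : E × ℝ → ℝ} (hg : ContDiff ℝ ∞ g)
    (hpos : ∀ y t, ∃ g' : ℝ, 0 < g' ∧ HasDerivAt (fun r => g (y, r)) g' t) (c : ℝ) :
    ∃ (N : Set E) (T : E → ℝ), IsOpen N ∧ ContDiffOn ℝ ∞ T N ∧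
      ∀ y t, g (y, t) = c ↔ y ∈ N ∧ t = T y := by
  have hmono (y : E) : StrictMono fun r => g (y, r) := strictMono_of_deriv_pos fun t => by
    obtain ⟨g', h0, h1⟩ := hpos y t
    rwa [h1.deriv]
  set N : Set E := {y | ∃ t, g (y, t) = c}
  have hT : ∀ y, ∃ t, y ∈ N → g (y, t) = c := fun y => by
    by_cases hy : y ∈ N
    · exact hy.imp fun t ht _ => ht
    · exact ⟨0, fun h => absurd h hy⟩
  choose T hT using hT
  have hiff (y t) : g (y, t) = c ↔ y ∈ N ∧ t = T y :=
    ⟨fun h => ⟨⟨t, h⟩, (hmono y).injective (h.trans (hT y ⟨t, h⟩).symm)⟩,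
      fun h => h.2 ▸ hT y h.1⟩
  have hloc : ∀ y ∈ N, ∃ φ : E → ℝ, ContDiffAt ℝ ∞ φ y ∧ ∀ᶠ x in nhds y, g (x, φ x) = c := by
    intro y hy
    have cdf : ContDiffAt ℝ ∞ g (y, T y) := hg.contDiffAt
    have inv : (fderiv ℝ g (y, T y) ∘L .inr ℝ E ℝ).IsInvertible := by
      obtain ⟨g', h0, h1⟩ := hpos y (T y)
      refine ⟨ContinuousLinearEquiv.unitsEquivAut ℝ (Units.mk0 g' h0.ne'), ?_⟩
      have h2 := ((hg.differentiable (by simp)) (y, T y)).hasFDerivAt.comp (T y)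
        (hasFDerivAt_prodMk_right y (T y))
      have h3 := h1.hasFDerivAt.unique h2
      rw [← h3]
      ext
      simp
    refine ⟨cdf.implicitFunction (by simp) inv, cdf.contDiffAt_implicitFunction (by simp) inv, ?_⟩
    filter_upwards [cdf.eventually_apply_implicitFunction (by simp) inv] with x hx
    rw [hx, hT y hy]
  refine ⟨N, T, ?_, ?_, hiff⟩
  · rw [isOpen_iff_mem_nhds]
    intro y hy
    obtain ⟨φ, -, h⟩ := hloc y hy
    filter_upwards [h] with x hx using ⟨_, hx⟩
  · intro y hy
    obtain ⟨φ, h1, h2⟩ := hloc y hy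
    refine (h1.congr_of_eventuallyEq ?_).contDiffWithinAt
    filter_upwards [h2] with x hx using (((hiff _ _).1 hx).2).symm

/-! ### Adapted frames -/

/-- The real coordinate vector `(1, 1 - Q(y), y)`. -/
def slice (Q : (Fin 4 → ℝ) → ℝ) (y : Fin 4 → ℝ) : Fin 6 → ℝ := Fin.cons 1 (Fin.cons (1 - Q y) y)

/-- Complex linear coordinates on `ℂ⁶`, orthogonal for the Hermitian product, in which a
one-parameter group of isometries acts diagonally with weights `√-1 nₗ`, and in which the
quadric has the equation `x₀ x₁ + Q(x₂, …, x₅) = 1` on the translates of the real points by the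
complexified group. -/
structure AdaptedFrame where
  /-- the coordinate vectors, as columns -/
  B : Matrix (Fin 6) (Fin 6) ℂ
  /-- the weights -/
  n : Fin 6 → ℤ
  /-- the square lengths of the coordinate vectors -/
  d : Fin 6 → ℝ
  /-- the last part of the equation of the quadric -/
  Q : (Fin 4 → ℝ) → ℝ
  /-- the gradient of `Q` -/
  G : (Fin 4 → ℝ) → Fin 4 → ℝ
  herm : ∀ x y : Fin 6 → ℂ, (B.mulVec x) ⬝ᵥ star (B.mulVec y) = ∑ l, (d l : ℂ) * (x l * star (y l))
  d_pos : ∀ l, 0 < d l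
  quad : ∀ ζ : ℂ, ζ ≠ 0 → ∀ v : Fin 6 → ℝ, ∑ i, (B.mulVec fun l => ζ ^ n l * (v l : ℂ)) i ^ 2 =
    ((v 0 * v 1 + Q fun j => v j.succ.succ : ℝ) : ℂ)
  smooth : ContDiff ℝ ∞ Q
  hasGrad : ∀ y, HasFDerivAt Q
    (∑ j, G y j • ContinuousLinearMap.proj (R := ℝ) (φ := fun _ : Fin 4 => ℝ) j) y
  n_zero : n 0 = 1
  n_sum : ∑ l, n l = 0
  det : ∀ y, Matrix.det (Matrix.of (Fin.cons (slice Q y) (Fin.cons (fun l => n l * slice Q y l)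
    fun j => Fin.cons 0 (Fin.cons (-G y j) (Pi.single j 1))) : Fin 6 → Fin 6 → ℝ)) = -2

namespace AdaptedFrame

variable (F : AdaptedFrame)

/-- The vector with coordinates `(e^{nₗ σ} ξₗ)`. -/
def vec (σ : ℂ) (ξ : Fin 6 → ℂ) : Fin 6 → ℂ := F.B.mulVec fun l => Complex.exp (F.n l * σ) * ξ l

/-- The real coordinates `(1, 1 - Q(y), y)`, as complex numbers. -/
def base (y : Fin 4 → ℝ) : Fin 6 → ℂ := fun l => (slice F.Q y l : ℂ)

/-- The derivative of `base`. -/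
def dbase (y δ : Fin 4 → ℝ) : Fin 6 → ℝ := Fin.cons 0 (Fin.cons (-∑ j, F.G y j * δ j) δ)

/-- `Im σ` is the angle of an isometry and drops out: all Hermitian quantities depend on `Re σ`
alone. -/
theorem vec_dotProduct_star (σ : ℂ) (ξ ξ' : Fin 6 → ℂ) :
    F.vec σ ξ ⬝ᵥ star (F.vec σ ξ') =
      ∑ l, ((F.d l * Real.exp (2 * F.n l * σ.re) : ℝ) : ℂ) * (ξ l * star (ξ' l)) := by
  rw [vec, vec, F.herm]
  refine Finset.sum_congr rfl fun l _ => ?_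
  have h : Complex.exp (F.n l * σ) * star (Complex.exp (F.n l * σ)) =
      (Real.exp (2 * F.n l * σ.re) : ℝ) := by
    rw [Complex.star_def, ← Complex.exp_conj, ← Complex.exp_add, Complex.ofReal_exp]
    congr 1
    apply Complex.ext
    · simp; ring
    · simp
  push_cast [← h]
  rw [star_mul']
  ring

theorem vec_eq_zero {σ : ℂ} {ξ : Fin 6 → ℂ} (h : F.vec σ ξ = 0) : ξ = 0 := by
  have h1 := F.vec_dotProduct_star σ ξ ξ
  rw [h] at h1
  have h2 : ∑ l, F.d l * Real.exp (2 * F.n l * σ.re) * Complex.normSq (ξ l) = 0 := by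
    have : ((∑ l, F.d l * Real.exp (2 * F.n l * σ.re) * Complex.normSq (ξ l) : ℝ) : ℂ) = 0 := by
      rw [zero_dotProduct] at h1
      rw [h1]
      push_cast
      simp only [Complex.star_def, Complex.mul_conj]
    exact_mod_cast this
  funext l
  have h3 := (Finset.sum_eq_zero_iff_of_nonneg fun l _ => mul_nonneg
    (mul_nonneg (F.d_pos l).le (Real.exp_pos _).le) (Complex.normSq_nonneg (ξ l))).1 h2 l
    (Finset.mem_univ l)
  have h4 := (mul_pos (F.d_pos l) (Real.exp_pos (2 * F.n l * σ.re))).ne'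
  exact Complex.normSq_eq_zero.1 ((mul_eq_zero.1 h3).resolve_left h4)

theorem isUnit_det : IsUnit F.B.det := by
  rw [← Matrix.isUnit_iff_isUnit_det, ← Matrix.mulVec_injective_iff_isUnit]
  intro x y h
  have h' : F.vec 0 (x - y) = 0 := by
    have e : (fun l => Complex.exp (F.n l * 0) * (x - y) l) = x - y := by
      funext l
      simp
    rw [vec, e, Matrix.mulVec_sub, sub_eq_zero]
    exact h
  exact sub_eq_zero.1 (F.vec_eq_zero h')

theorem vec_base_eq (σ : ℂ) (y : Fin 4 → ℝ) : F.vec σ (F.base y) =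
    F.B.mulVec fun l => Complex.exp σ ^ F.n l * (slice F.Q y l : ℂ) := by
  simp only [vec, base, Complex.exp_int_mul]

theorem vec_base_mem (σ : ℂ) (y : Fin 4 → ℝ) : F.vec σ (F.base y) ∈ quadric 5 := by
  rw [vec_base_eq]
  refine (F.quad _ (Complex.exp_ne_zero σ) (slice F.Q y)).trans ?_
  have : (fun j : Fin 4 => slice F.Q y j.succ.succ) = y := rfl
  rw [this]
  have h0 : slice F.Q y 0 = 1 := rfl
  have h1 : slice F.Q y 1 = 1 - F.Q y := rfl
  rw [h0, h1]
  simp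

theorem hasDerivAt_slice {y : ℝ → Fin 4 → ℝ} {y' : Fin 4 → ℝ} {t : ℝ} (hy : HasDerivAt y y' t) :
    HasDerivAt (fun r => slice F.Q (y r)) (F.dbase (y t) y') t := by
  rw [hasDerivAt_pi]
  refine Fin.cases ?_ (Fin.cases ?_ fun j => ?_)
  · simpa [slice, dbase] using hasDerivAt_const t (1 : ℝ)
  · have h := ((F.hasGrad (y t)).comp_hasDerivAt t hy).const_sub 1
    simpa [slice, dbase] using h
  · simpa [slice, dbase] using (hasDerivAt_pi.1 hy) j

theorem hasDerivAt_vec {σ : ℝ → ℂ} {σ' : ℂ} {y : ℝ → Fin 4 → ℝ} {y' : Fin 4 → ℝ} {t : ℝ}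
    (hσ : HasDerivAt σ σ' t) (hy : HasDerivAt y y' t) :
    HasDerivAt (fun r => F.vec (σ r) (F.base (y r)))
      (F.vec (σ t) fun l => F.n l * σ' * F.base (y t) l + F.dbase (y t) y' l) t := by
  rw [hasDerivAt_pi]
  intro i
  have hl (l : Fin 6) : HasDerivAt (fun r => Complex.exp (F.n l * σ r) * F.base (y r) l)
      (Complex.exp (F.n l * σ t) * (F.n l * σ' * F.base (y t) l + F.dbase (y t) y' l)) t := by
    have h1 := ((hσ.const_mul (F.n l : ℂ)).cexp).mul
      ((hasDerivAt_pi.1 (F.hasDerivAt_slice hy) l).ofReal_comp)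
    refine h1.congr_deriv ?_
    simp only [base]
    ring
  simp only [vec, Matrix.mulVec, dotProduct]
  exact HasDerivAt.fun_sum fun l _ => (hl l).const_mul (F.B i l)

end AdaptedFrame

theorem dotProduct_eq_zero_of_hasDerivAt {γ : ℝ → Fin 6 → ℂ} {γ' : Fin 6 → ℂ} {t : ℝ}
    (hγ : HasDerivAt γ γ' t) (h : ∀ᶠ r in nhds t, γ r ∈ quadric 5) : γ t ⬝ᵥ γ' = 0 := by
  have h1 : HasDerivAt (fun r => ∑ i, γ r i ^ 2) (∑ i, 2 * (γ t i * γ' i)) t := by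
    refine HasDerivAt.fun_sum fun i _ => ((hasDerivAt_pi.1 hγ i).pow 2).congr_deriv ?_
    norm_num
    ring
  have h2 := h1.unique ((hasDerivAt_const t (1 : ℂ)).congr_of_eventuallyEq h)
  rw [← Finset.mul_sum] at h2
  simpa [dotProduct] using h2

/-! ### The moment map in the parameters of a frame -/

namespace AdaptedFrame

variable (F : AdaptedFrame)

theorem dotProduct_vec (σ σ' : ℂ) (y δ : Fin 4 → ℝ) : F.vec σ (F.base y) ⬝ᵥ
    F.vec σ (fun l => F.n l * σ' * F.base y l + F.dbase y δ l) = 0 := by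
  have h1 : HasDerivAt (fun r : ℝ => σ + r * σ') σ' 0 := by
    simpa using ((hasDerivAt_id (0 : ℝ)).ofReal_comp.mul_const σ').const_add σ
  have h2 : HasDerivAt (fun r : ℝ => y + r • δ) δ 0 := by
    simpa using ((hasDerivAt_id (0 : ℝ)).smul_const δ).const_add y
  have h := dotProduct_eq_zero_of_hasDerivAt (F.hasDerivAt_vec h1 h2)
    (.of_forall fun r => F.vec_base_mem _ _)
  simpa using h

/-- `r²` at the point with parameters `y` and `Re σ = t`. -/
def radius (p : (Fin 4 → ℝ) × ℝ) : ℝ :=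
  ∑ l, F.d l * Real.exp (2 * F.n l * p.2) * slice F.Q p.1 l ^ 2

/-- The pairing of the infinitesimal generator with the position, divided by `√-1`. -/
def weightedRadius (p : (Fin 4 → ℝ) × ℝ) : ℝ :=
  ∑ l, F.d l * Real.exp (2 * F.n l * p.2) * (F.n l * slice F.Q p.1 l ^ 2)

/-- The moment map in the parameters. -/
def moment (u : ℝ → ℝ) (p : (Fin 4 → ℝ) × ℝ) : ℝ := deriv u (F.radius p) * F.weightedRadius p

theorem rSq_vec (σ : ℂ) (y : Fin 4 → ℝ) : rSq (F.vec σ (F.base y)) = F.radius (y, σ.re) := by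
  have h := F.vec_dotProduct_star σ (F.base y) (F.base y)
  rw [dotProduct_star_self] at h
  rw [← Complex.ofReal_inj, h, radius]
  push_cast
  refine Finset.sum_congr rfl fun l _ => ?_
  simp only [base, Complex.star_def, Complex.conj_ofReal]
  ring

theorem one_le_radius (p : (Fin 4 → ℝ) × ℝ) : 1 ≤ F.radius p := by
  have h := one_le_rSq (F.vec_base_mem (p.2 : ℂ) p.1)
  rwa [rSq_vec] at h

theorem contDiff_slice (l : Fin 6) : ContDiff ℝ ∞ fun y => slice F.Q y l := by
  revert l
  refine Fin.cases ?_ (Fin.cases ?_ fun j => ?_)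
  · exact contDiff_const
  · exact contDiff_const.sub F.smooth
  · exact contDiff_apply ℝ ℝ j

theorem contDiff_moment {a : ℝ} {u : ℝ → ℝ} (hu : IsPotential 5 a u) :
    ContDiff ℝ ∞ (F.moment u) := by
  have hs (l) : ContDiff ℝ ∞ fun p : (Fin 4 → ℝ) × ℝ => slice F.Q p.1 l :=
    (F.contDiff_slice l).comp contDiff_fst
  have h1 : ContDiff ℝ ∞ F.radius := by
    unfold radius
    refine ContDiff.sum fun l _ => ?_
    have := hs l
    fun_prop
  have h2 : ContDiff ℝ ∞ F.weightedRadius := by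
    unfold weightedRadius
    refine ContDiff.sum fun l _ => ?_
    have := hs l
    fun_prop
  refine ContDiff.mul ?_ h2
  rw [contDiff_iff_contDiffAt]
  intro p
  exact (hu.contDiffAt_deriv (F.one_le_radius p)).comp p h1.contDiffAt

/-- The Levi form on real coordinate vectors. -/
def realLevi (f f' : ℝ) (p : (Fin 4 → ℝ) × ℝ) (r r' : Fin 6 → ℝ) : ℝ :=
  f * ∑ l, F.d l * Real.exp (2 * F.n l * p.2) * (r l * r' l) +
    f' * ((∑ l, F.d l * Real.exp (2 * F.n l * p.2) * (r l * slice F.Q p.1 l)) *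
      ∑ l, F.d l * Real.exp (2 * F.n l * p.2) * (slice F.Q p.1 l * r' l))

/-- On real coordinate vectors the Levi form is real; this is what makes the charts Lagrangian. -/
theorem leviForm_vec (f f' : ℝ) (σ : ℂ) (y : Fin 4 → ℝ) (r r' : Fin 6 → ℝ) :
    leviForm f f' (F.vec σ (F.base y)) (F.vec σ fun l => r l) (F.vec σ fun l => r' l) =
      F.realLevi f f' (y, σ.re) r r' := by
  simp only [leviForm, vec_dotProduct_star, realLevi, base]
  push_cast
  simp

/-- The coordinates of the infinitesimal generator, divided by `√-1`. -/
def weight (y : Fin 4 → ℝ) : Fin 6 → ℝ := fun l => F.n l * slice F.Q y l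

/-- The defining property of a moment map in real coordinates: its differential is the pairing of
the generator with the tangent vector. Both the monotonicity in `Re σ` and the vanishing of the
Kähler form on the level come from this formula. -/
theorem hasDerivAt_moment {a : ℝ} {u : ℝ → ℝ} (hu : IsPotential 5 a u) {y : ℝ → Fin 4 → ℝ}
    {y' : Fin 4 → ℝ} {τ : ℝ → ℝ} {τ' t : ℝ} (hy : HasDerivAt y y' t) (hτ : HasDerivAt τ τ' t) :
    HasDerivAt (fun r => F.moment u (y r, τ r))
      (2 * F.realLevi (deriv u (F.radius (y t, τ t))) (deriv (deriv u) (F.radius (y t, τ t)))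
        (y t, τ t) (F.weight (y t)) (fun l => F.n l * τ' * slice F.Q (y t) l + F.dbase (y t) y' l))
      t := by
  have hE (l : Fin 6) : HasDerivAt (fun r => F.d l * Real.exp (2 * F.n l * τ r))
      (F.d l * Real.exp (2 * F.n l * τ t) * (2 * F.n l * τ')) t :=
    (((hτ.const_mul (2 * F.n l : ℝ)).exp).const_mul (F.d l)).congr_deriv (by ring)
  have hS (l : Fin 6) : HasDerivAt (fun r => slice F.Q (y r) l ^ 2)
      (2 * slice F.Q (y t) l * F.dbase (y t) y' l) t :=
    ((hasDerivAt_pi.1 (F.hasDerivAt_slice hy) l).pow 2).congr_deriv (by norm_num)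
  have h1 : HasDerivAt (fun r => F.radius (y r, τ r))
      (2 * ∑ l, F.d l * Real.exp (2 * F.n l * τ t) * (slice F.Q (y t) l *
        (F.n l * τ' * slice F.Q (y t) l + F.dbase (y t) y' l))) t := by
    rw [Finset.mul_sum]
    exact HasDerivAt.fun_sum fun l _ => ((hE l).mul (hS l)).congr_deriv (by ring)
  have h2 : HasDerivAt (fun r => F.weightedRadius (y r, τ r))
      (2 * ∑ l, F.d l * Real.exp (2 * F.n l * τ t) * (F.weight (y t) l *
        (F.n l * τ' * slice F.Q (y t) l + F.dbase (y t) y' l))) t := by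
    rw [Finset.mul_sum]
    exact HasDerivAt.fun_sum fun l _ =>
      ((hE l).mul ((hS l).const_mul (F.n l : ℝ))).congr_deriv (by simp only [weight]; ring)
  have h3 := ((hu.hasDerivAt_deriv (F.one_le_radius (y t, τ t))).comp t h1).mul h2
  refine h3.congr_deriv ?_
  have e : F.weightedRadius (y t, τ t) = ∑ l, F.d l * Real.exp (2 * F.n l * τ t) *
      (F.weight (y t) l * slice F.Q (y t) l) :=
    Finset.sum_congr rfl fun l _ => by simp only [weight]; ring
  simp only [Function.comp, e, realLevi]
  ring

theorem realLevi_weight_pos {a : ℝ} {u : ℝ → ℝ} (hu : IsPotential 5 a u) (p : (Fin 4 → ℝ) × ℝ) :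
    0 < F.realLevi (deriv u (F.radius p)) (deriv (deriv u) (F.radius p)) p (F.weight p.1)
      (F.weight p.1) := by
  have hz := F.vec_base_mem (p.2 : ℂ) p.1
  have hd : F.dbase p.1 0 = 0 := by
    funext l
    revert l
    refine Fin.cases rfl (Fin.cases (by simp [dbase]) fun j => rfl)
  have h1 := F.dotProduct_vec (p.2 : ℂ) 1 p.1 0
  have e : (fun l => (F.n l : ℂ) * 1 * F.base p.1 l + F.dbase p.1 0 l) =
      fun l => (F.weight p.1 l : ℂ) := by
    funext l
    simp [hd, weight, base]
  rw [e] at h1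
  have h2 := leviForm_self_pos hu hz h1 fun h0 => by
    have := congrFun (F.vec_eq_zero h0) 0
    simp [weight, F.n_zero, slice] at this
  have h3 := F.leviForm_vec (deriv u (F.radius p)) (deriv (deriv u) (F.radius p)) p.2 p.1
    (F.weight p.1) (F.weight p.1)
  rw [leviForm_self, Complex.ofReal_inj] at h3
  rw [rSq_vec] at h2
  simp only [Complex.ofReal_re] at h2 h3
  rwa [h3] at h2

theorem exists_moment_solution {a : ℝ} {u : ℝ → ℝ} (hu : IsPotential 5 a u) (c : ℝ) :
    ∃ (N : Set (Fin 4 → ℝ)) (T : (Fin 4 → ℝ) → ℝ), IsOpen N ∧ ContDiffOn ℝ ∞ T N ∧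
      ∀ y t, F.moment u (y, t) = c ↔ y ∈ N ∧ t = T y := by
  refine exists_smooth_solution (F.contDiff_moment hu) (fun y t => ?_) c
  refine ⟨_, ?_, F.hasDerivAt_moment hu (hasDerivAt_const t y) (hasDerivAt_id t)⟩
  have hd : F.dbase y 0 = 0 := by
    funext l
    revert l
    refine Fin.cases rfl (Fin.cases (by simp [dbase]) fun j => rfl)
  have e : (fun l => (F.n l : ℝ) * 1 * slice F.Q y l + F.dbase y 0 l) = F.weight y := by
    funext l
    simp [hd, weight]
  simp only [e]
  exact mul_pos two_pos (F.realLevi_weight_pos hu (y, t))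

end AdaptedFrame

/-! ### From charts with constant determinant to the Lagrangian angle -/

theorem leviForm_add_smul {m : ℕ} (f f' : ℝ) (z v v' w w' : Fin m → ℂ) (s t : ℂ) :
    leviForm f f' z (v + s • v') (w + t • w') = leviForm f f' z v w +
      star t * leviForm f f' z v w' + s * leviForm f f' z v' w +
      s * star t * leviForm f f' z v' w' := by
  simp only [leviForm, star_add, star_smul, add_dotProduct, dotProduct_add, smul_dotProduct,
    dotProduct_smul, smul_eq_mul]
  ring

/-- The common properties of the local parametrizations that show that a set is a special
Lagrangian submanifold. -/
structure IsSpecialChart (u : ℝ → ℝ) (S : Set (Fin 6 → ℂ)) (κ : ℂ) (W : Set (Fin 5 → ℝ))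
    (ψ : (Fin 5 → ℝ) → Fin 6 → ℂ) : Prop where
  param : IsLocalParametrization 5 S W ψ
  lagrangian : ∀ y ∈ W, ∀ s t, kahlerForm u (ψ y) (fderiv ℝ ψ y s) (fderiv ℝ ψ y t) = 0
  det : ∀ y ∈ W, Matrix.det (Matrix.of (Fin.cons (ψ y) fun i => fderiv ℝ ψ y (Pi.single i 1) :
    Fin 6 → Fin 6 → ℂ)) = κ

theorem isLagrangian_of_charts {u : ℝ → ℝ} {S : Set (Fin 6 → ℂ)} {κ : ℂ} (hS : S ⊆ quadric 5)
    (h : ∀ p ∈ S, ∃ W ψ, IsSpecialChart u S κ W ψ ∧ p ∈ ψ '' W) : IsLagrangian 5 u S :=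
  ⟨hS, fun p hp => by
    obtain ⟨W, ψ, h1, h2⟩ := h p hp
    exact ⟨W, ψ, h1.param, h2, h1.lagrangian⟩⟩

theorem hasPhase_of_charts {a : ℝ} {u : ℝ → ℝ} (hu : IsPotential 5 a u) {lam : ℂ}
    (hlam : ‖lam‖ ^ 2 = 2 ^ 5 * a) {S : Set (Fin 6 → ℂ)} {κ : ℂ} (hS : S ⊆ quadric 5)
    (h : ∀ p ∈ S, ∃ W ψ, IsSpecialChart u S κ W ψ ∧ p ∈ ψ '' W) :
    HasPhase 5 u lam S (lam * κ).arg := by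
  intro p hp
  obtain ⟨W, ψ, h1, h2⟩ := h p hp
  refine ⟨W, ψ, h1.param, h2, fun y hy => ?_⟩
  have hmem : ∀ x ∈ W, ψ x ∈ quadric 5 := fun x hx => by
    obtain ⟨O, χ, -, hO, -⟩ := h1.param.embedding
    exact hS (hO ▸ Set.mem_image_of_mem ψ hx : ψ x ∈ S ∩ O).1
  have hdiff : DifferentiableAt ℝ ψ y :=
    (h1.param.smooth.contDiffAt (h1.param.isOpen.mem_nhds hy)).differentiableAt (by simp)
  have htan (s : Fin 5 → ℝ) : ψ y ⬝ᵥ fderiv ℝ ψ y s = 0 := by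
    have hl : HasDerivAt (fun r : ℝ => y + r • s) s 0 := by
      simpa using ((hasDerivAt_id (0 : ℝ)).smul_const s).const_add y
    have hd : HasFDerivAt ψ (fderiv ℝ ψ y) (y + (0 : ℝ) • s) := by simpa using hdiff.hasFDerivAt
    have hev : ∀ᶠ r : ℝ in nhds 0, ψ (y + r • s) ∈ quadric 5 := by
      have := hl.continuousAt.preimage_mem_nhds (by
        simpa using h1.param.isOpen.mem_nhds hy)
      filter_upwards [this] with r hr using hmem _ hr
    simpa using dotProduct_eq_zero_of_hasDerivAt (hd.comp_hasDerivAt 0 hl) hev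
  -- The square root of the Gram determinant becomes `‖λκ‖`, and what remains is the polar form of
  -- `λκ`.
  rw [normSq_volumeForm hu hlam (hmem y hy) _ (fun i => htan _)
    (fun i j => h1.lagrangian y hy _ _), Real.sqrt_sq (norm_nonneg _), volumeForm, h1.det y hy,
    mul_comm (Complex.exp _), mul_comm Complex.I]
  exact (Complex.norm_mul_exp_arg_mul_I _).symm

/-! ### The swept-out level set and its charts -/

namespace AdaptedFrame

variable (F : AdaptedFrame)

/-- The part of the quadric swept out from the real points by the complexified group, on a level
set of the moment map. -/
def orbit (u : ℝ → ℝ) (c : ℝ) : Set (Fin 6 → ℂ) :=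
  {z | z ∈ quadric 5 ∧ ∃ ζ : ℂ, ζ ≠ 0 ∧ ∃ v : Fin 6 → ℝ,
    (z = F.B.mulVec fun l => ζ ^ F.n l * (v l : ℂ)) ∧
    deriv u (rSq z) * ∑ l, F.d l * (F.n l * Complex.normSq (ζ ^ F.n l * (v l : ℂ))) = c}

theorem sum_normSq_exp (σ : ℂ) (y : Fin 4 → ℝ) :
    ∑ l, F.d l * (F.n l * Complex.normSq (Complex.exp σ ^ F.n l * (slice F.Q y l : ℂ))) =
      F.weightedRadius (y, σ.re) := by
  refine Finset.sum_congr rfl fun l _ => ?_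
  have h : Complex.normSq (Complex.exp σ ^ F.n l) = Real.exp (2 * F.n l * σ.re) := by
    rw [← Complex.exp_int_mul, Complex.normSq_eq_norm_sq, Complex.norm_exp, ← Real.exp_nat_mul]
    congr 1
    simp
    ring
  rw [Complex.normSq_mul, h, Complex.normSq_ofReal]
  ring

theorem vec_base_mem_orbit {u : ℝ → ℝ} {c : ℝ} {σ : ℂ} {y : Fin 4 → ℝ}
    (h : F.moment u (y, σ.re) = c) : F.vec σ (F.base y) ∈ F.orbit u c := by
  refine ⟨F.vec_base_mem σ y, Complex.exp σ, Complex.exp_ne_zero σ, slice F.Q y,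
    F.vec_base_eq σ y, ?_⟩
  rw [sum_normSq_exp, rSq_vec, ← h, moment]

/-- The freedom `(ζ, v) ↦ (ζ v₀, v_l v₀^{-n_l})` keeps the point and keeps `v` real while it makes
the first real coordinate `1`; the equation of the quadric then determines the second one. -/
theorem exists_eq_vec_base {u : ℝ → ℝ} {c : ℝ} {z : Fin 6 → ℂ} (hz : z ∈ F.orbit u c) {σ : ℂ}
    (hσ : (F.B⁻¹.mulVec z) 0 = Complex.exp σ) :
    ∃ y, z = F.vec σ (F.base y) ∧ F.moment u (y, σ.re) = c := by
  obtain ⟨hq, ζ, hζ, v, rfl, hc⟩ := hz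
  rw [Matrix.mulVec_mulVec, Matrix.nonsing_inv_mul _ F.isUnit_det, Matrix.one_mulVec, F.n_zero,
    zpow_one] at hσ
  have hv : v 0 ≠ 0 := fun h => by
    rw [h] at hσ
    exact Complex.exp_ne_zero σ (by rw [← hσ]; simp)
  set y : Fin 4 → ℝ := fun j => v j.succ.succ * v 0 ^ (-F.n j.succ.succ) with hy
  have hx (l : Fin 6) : ζ ^ F.n l * (v l : ℂ) =
      Complex.exp σ ^ F.n l * ((v l * v 0 ^ (-F.n l) : ℝ) : ℂ) := by
    have hv' : (v 0 : ℂ) ≠ 0 := by exact_mod_cast hv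
    rw [← hσ, mul_zpow]
    push_cast
    rw [zpow_neg]
    field_simp
  have hs : (fun l => v l * v 0 ^ (-F.n l)) = slice F.Q y := by
    have h1 := F.quad _ (Complex.exp_ne_zero σ) (fun l => v l * v 0 ^ (-F.n l))
    simp only [← hx] at h1
    rw [show ∑ i, (F.B.mulVec fun l => ζ ^ F.n l * (v l : ℂ)) i ^ 2 = 1 from hq] at h1
    have h0 : v 0 * v 0 ^ (-F.n 0) = 1 := by
      rw [F.n_zero, zpow_neg, zpow_one, mul_inv_cancel₀ hv]
    rw [h0] at h1
    have h1' : 1 = v 1 * v 0 ^ (-F.n 1) + F.Q y := by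
      have : (1 : ℝ) = 1 * (v 1 * v 0 ^ (-F.n 1)) + F.Q y := by exact_mod_cast h1
      linarith
    funext l
    revert l
    refine Fin.cases h0 (Fin.cases ?_ fun j => rfl)
    change v 1 * v 0 ^ (-F.n 1) = 1 - F.Q y
    linarith
  have hx' (l : Fin 6) : ζ ^ F.n l * (v l : ℂ) = Complex.exp σ ^ F.n l * (slice F.Q y l : ℂ) := by
    rw [hx l, ← hs]
  simp only [hx', ← vec_base_eq, sum_normSq_exp, rSq_vec] at hc ⊢
  exact ⟨y, rfl, hc⟩

theorem inv_mulVec_vec (σ : ℂ) (ξ : Fin 6 → ℂ) :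
    F.B⁻¹.mulVec (F.vec σ ξ) = fun l => Complex.exp (F.n l * σ) * ξ l := by
  rw [vec, Matrix.mulVec_mulVec, Matrix.nonsing_inv_mul _ F.isUnit_det, Matrix.one_mulVec]

/-- The parametrization of the orbit by an angle and a slice of the real points, for a solution
`T` of the moment map equation. -/
def chart (T : (Fin 4 → ℝ) → ℝ) (x : Fin 5 → ℝ) : Fin 6 → ℂ :=
  F.vec (T (Fin.tail x) + x 0 * Complex.I) (F.base (Fin.tail x))

/-- The domain of `chart`. -/
def chartDomain (N : Set (Fin 4 → ℝ)) (θ : ℝ) : Set (Fin 5 → ℝ) :=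
  {x | Fin.tail x ∈ N ∧ x 0 ∈ Set.Ioo (θ - Real.pi) (θ + Real.pi)}

theorem contDiff_tail : ContDiff ℝ ∞ (Fin.tail : (Fin 5 → ℝ) → Fin 4 → ℝ) :=
  contDiff_pi.2 fun j => contDiff_apply ℝ ℝ j.succ

theorem isOpen_chartDomain {N : Set (Fin 4 → ℝ)} (hN : IsOpen N) (θ : ℝ) :
    IsOpen (chartDomain N θ) :=
  (hN.preimage contDiff_tail.continuous).inter (isOpen_Ioo.preimage (continuous_apply 0))

theorem contDiffOn_chart {N : Set (Fin 4 → ℝ)} {T : (Fin 4 → ℝ) → ℝ} (hT : ContDiffOn ℝ ∞ T N)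
    (θ : ℝ) : ContDiffOn ℝ ∞ (F.chart T) (chartDomain N θ) := by
  rw [contDiffOn_pi]
  intro i
  have h1 : ContDiffOn ℝ ∞ (fun x : Fin 5 → ℝ => ((T (Fin.tail x) : ℝ) : ℂ)) (chartDomain N θ) :=
    Complex.ofRealCLM.contDiff.comp_contDiffOn
      (hT.comp contDiff_tail.contDiffOn fun x hx => hx.1)
  have h2 : ContDiff ℝ ∞ (fun x : Fin 5 → ℝ => ((x 0 : ℝ) : ℂ)) :=
    Complex.ofRealCLM.contDiff.comp (contDiff_apply ℝ ℝ 0)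
  have h3 (l) : ContDiff ℝ ∞ (fun x : Fin 5 → ℝ => ((slice F.Q (Fin.tail x) l : ℝ) : ℂ)) :=
    Complex.ofRealCLM.contDiff.comp ((F.contDiff_slice l).comp contDiff_tail)
  simp only [chart, vec, Matrix.mulVec, dotProduct, base]
  refine ContDiffOn.sum fun l _ => contDiffOn_const.mul (ContDiffOn.mul ?_ (h3 l).contDiffOn)
  exact (contDiffOn_const.mul (h1.add (h2.contDiffOn.mul contDiffOn_const))).cexp

/-- The real part of the coordinates of the derivative of `chart`. -/
def chartDeriv (T : (Fin 4 → ℝ) → ℝ) (x s : Fin 5 → ℝ) : Fin 6 → ℝ := fun l =>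
  F.n l * fderiv ℝ T (Fin.tail x) (Fin.tail s) * slice F.Q (Fin.tail x) l +
    F.dbase (Fin.tail x) (Fin.tail s) l

/-! ### Tangent vectors, Kähler form and determinant of the charts -/

section

variable {N : Set (Fin 4 → ℝ)} {T : (Fin 4 → ℝ) → ℝ} {θ : ℝ} {x : Fin 5 → ℝ}

theorem hasDerivAt_line {E : Type*} [NormedAddCommGroup E] [NormedSpace ℝ E] (x s : E) :
    HasDerivAt (fun r : ℝ => x + r • s) s 0 := by
  simpa using ((hasDerivAt_id (0 : ℝ)).smul_const s).const_add x

theorem fderiv_chart (hN : IsOpen N) (hT : ContDiffOn ℝ ∞ T N) (hx : x ∈ chartDomain N θ)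
    (s : Fin 5 → ℝ) : fderiv ℝ (F.chart T) x s =
      F.vec (T (Fin.tail x) + x 0 * Complex.I) (fun l => F.chartDeriv T x s l) +
        (Complex.I * s 0) • F.vec (T (Fin.tail x) + x 0 * Complex.I)
          fun l => F.weight (Fin.tail x) l := by
  have hψ : DifferentiableAt ℝ (F.chart T) x := ((F.contDiffOn_chart hT θ).contDiffAt
    ((isOpen_chartDomain hN θ).mem_nhds hx)).differentiableAt (by simp)
  have hTd : DifferentiableAt ℝ T (Fin.tail x) :=
    (hT.contDiffAt (hN.mem_nhds hx.1)).differentiableAt (by simp)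
  have h1 : HasDerivAt (fun r : ℝ => F.chart T (x + r • s)) (fderiv ℝ (F.chart T) x s) 0 := by
    have : HasFDerivAt (F.chart T) (fderiv ℝ (F.chart T) x) (x + (0 : ℝ) • s) := by
      simpa using hψ.hasFDerivAt
    exact this.comp_hasDerivAt 0 (hasDerivAt_line x s)
  have h2 : HasDerivAt (fun r : ℝ => T (Fin.tail x + r • Fin.tail s))
      (fderiv ℝ T (Fin.tail x) (Fin.tail s)) 0 := by
    have : HasFDerivAt T (fderiv ℝ T (Fin.tail x)) (Fin.tail x + (0 : ℝ) • Fin.tail s) := by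
      simpa using hTd.hasFDerivAt
    exact this.comp_hasDerivAt 0 (hasDerivAt_line _ _)
  have h3 : HasDerivAt (fun r : ℝ => x 0 + r * s 0) (s 0) 0 := by
    simpa using hasDerivAt_line (x 0) (s 0)
  have h4 := F.hasDerivAt_vec (h2.ofReal_comp.add (h3.ofReal_comp.mul_const Complex.I))
    (hasDerivAt_line (Fin.tail x) (Fin.tail s))
  have h5 := h1.unique h4
  rw [h5]
  simp only [zero_smul, add_zero, zero_mul, Pi.add_apply, vec, ← Matrix.mulVec_smul,
    ← Matrix.mulVec_add]
  congr 1
  funext l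
  simp [chartDeriv, weight, base]
  ring

/-- The moment map is constant along the graph of `T`, so its derivative, twice this pairing,
vanishes. -/
theorem realLevi_chartDeriv {a : ℝ} {u : ℝ → ℝ} (hu : IsPotential 5 a u) {c : ℝ} (hN : IsOpen N)
    (hT : ContDiffOn ℝ ∞ T N) (hc : ∀ y ∈ N, F.moment u (y, T y) = c) (hx : x ∈ chartDomain N θ)
    (s : Fin 5 → ℝ) :
    F.realLevi (deriv u (F.radius (Fin.tail x, T (Fin.tail x))))
      (deriv (deriv u) (F.radius (Fin.tail x, T (Fin.tail x)))) (Fin.tail x, T (Fin.tail x))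
      (F.weight (Fin.tail x)) (F.chartDeriv T x s) = 0 := by
  have hTd : DifferentiableAt ℝ T (Fin.tail x) :=
    (hT.contDiffAt (hN.mem_nhds hx.1)).differentiableAt (by simp)
  have h2 : HasDerivAt (fun r : ℝ => T (Fin.tail x + r • Fin.tail s))
      (fderiv ℝ T (Fin.tail x) (Fin.tail s)) 0 := by
    have : HasFDerivAt T (fderiv ℝ T (Fin.tail x)) (Fin.tail x + (0 : ℝ) • Fin.tail s) := by
      simpa using hTd.hasFDerivAt
    exact this.comp_hasDerivAt 0 (hasDerivAt_line _ _)
  have h3 := F.hasDerivAt_moment hu (hasDerivAt_line (Fin.tail x) (Fin.tail s)) h2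
  have h4 : (fun r : ℝ => F.moment u (Fin.tail x + r • Fin.tail s,
      T (Fin.tail x + r • Fin.tail s))) =ᶠ[nhds 0] fun _ => c := by
    have := (hasDerivAt_line (Fin.tail x) (Fin.tail s)).continuousAt.preimage_mem_nhds
      (t := N) (by simpa using hN.mem_nhds hx.1)
    filter_upwards [this] with r hr using hc _ hr
  have h5 := h3.unique ((hasDerivAt_const (0 : ℝ) c).congr_of_eventuallyEq h4)
  have h6 := (mul_eq_zero.1 h5).resolve_left two_ne_zero
  simp only [zero_smul, add_zero] at h6
  exact h6

theorem realLevi_comm (f f' : ℝ) (p : (Fin 4 → ℝ) × ℝ) (r r' : Fin 6 → ℝ) :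
    F.realLevi f f' p r r' = F.realLevi f f' p r' r := by
  have h : ∑ l, F.d l * Real.exp (2 * F.n l * p.2) * (r l * r' l) =
      ∑ l, F.d l * Real.exp (2 * F.n l * p.2) * (r' l * r l) :=
    Finset.sum_congr rfl fun l _ => by ring
  have h' (r : Fin 6 → ℝ) : ∑ l, F.d l * Real.exp (2 * F.n l * p.2) * (r l * slice F.Q p.1 l) =
      ∑ l, F.d l * Real.exp (2 * F.n l * p.2) * (slice F.Q p.1 l * r l) :=
    Finset.sum_congr rfl fun l _ => by ring
  rw [realLevi, realLevi, h, h', h']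
  ring

theorem kahlerForm_chart {a : ℝ} {u : ℝ → ℝ} (hu : IsPotential 5 a u) {c : ℝ} (hN : IsOpen N)
    (hT : ContDiffOn ℝ ∞ T N) (hc : ∀ y ∈ N, F.moment u (y, T y) = c) (hx : x ∈ chartDomain N θ)
    (s t : Fin 5 → ℝ) :
    kahlerForm u (F.chart T x) (fderiv ℝ (F.chart T) x s) (fderiv ℝ (F.chart T) x t) = 0 := by
  have hmem : F.chart T x ∈ quadric 5 := F.vec_base_mem _ _
  have hr : rSq (F.chart T x) = F.radius (Fin.tail x, T (Fin.tail x)) := by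
    rw [chart, rSq_vec]
    simp
  have h0 (s) := F.realLevi_chartDeriv hu hN hT hc hx s
  rw [kahlerForm_eq hu (one_le_rSq hmem), hr, F.fderiv_chart hN hT hx, F.fderiv_chart hN hT hx,
    leviForm_add_smul, chart, leviForm_vec, leviForm_vec, leviForm_vec, leviForm_vec]
  have hre : (((T (Fin.tail x) : ℝ) : ℂ) + x 0 * Complex.I).re = T (Fin.tail x) := by simp
  rw [hre, h0, realLevi_comm, F.realLevi_comm _ _ _ (F.chartDeriv T x s) (F.weight _), h0]
  simp

/-- Row operations remove the derivatives of `T`, the diagonal factor `e^{n_l σ}` has determinant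
`1` because the weights sum to `0`, and the angular row carries one factor `√-1`. Nothing depends on
the point. -/
theorem det_chart (hN : IsOpen N) (hT : ContDiffOn ℝ ∞ T N) (hx : x ∈ chartDomain N θ) :
    Matrix.det (Matrix.of (Fin.cons (F.chart T x)
      fun i => fderiv ℝ (F.chart T) x (Pi.single i 1) : Fin 6 → Fin 6 → ℂ)) =
      -2 * Complex.I * F.B.det := by
  set y := Fin.tail x with hy
  set σ : ℂ := T y + x 0 * Complex.I with hσ
  set D : Matrix (Fin 6) (Fin 6) ℝ := Matrix.of (Fin.cons (slice F.Q y) (Fin.cons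
    (fun l => F.n l * slice F.Q y l)
    fun j => Fin.cons 0 (Fin.cons (-F.G y j) (Pi.single j 1))) : Fin 6 → Fin 6 → ℝ) with hD
  have hDdet : D.det = -2 := F.det y
  set e : Fin 6 → ℂ := ![1, Complex.I, 1, 1, 1, 1]
  set R : Matrix (Fin 6) (Fin 6) ℂ := Matrix.diagonal e * D.map Complex.ofRealHom with hR
  -- Row `1` of `R` is `√-1` times the weight vector, so the coefficient `-√-1 ∂ⱼT` adds `∂ⱼT` times
  -- the weight vector to row `j + 2`, as in `∂ⱼψ`.
  set k : Fin 6 → ℂ := Fin.cons 0 (Fin.cons 0 fun j : Fin 4 =>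
    -Complex.I * (fderiv ℝ T y (Pi.single j 1) : ℝ)) with hk
  set R' : Matrix (Fin 6) (Fin 6) ℂ := Matrix.of fun i j => R i j + k i * R 1 j with hR'
  have hRdet : R'.det = -2 * Complex.I := by
    have h : R'.det = R.det :=
      Matrix.det_eq_of_forall_row_eq_smul_add_const k 1 rfl fun i j => rfl
    rw [h, hR,
      Matrix.det_mul, Matrix.det_diagonal, ← RingHom.mapMatrix_apply, ← RingHom.map_det, hDdet]
    simp [e, Fin.prod_univ_succ]
    ring
  have hprod : (Matrix.diagonal fun l => Complex.exp (F.n l * σ)).det = 1 := by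
    rw [Matrix.det_diagonal, ← Complex.exp_sum, ← Finset.sum_mul]
    have : ∑ l, (F.n l : ℂ) = 0 := by exact_mod_cast F.n_sum
    rw [this]
    simp
  have hM : (Matrix.of (Fin.cons (F.chart T x)
      fun i => fderiv ℝ (F.chart T) x (Pi.single i 1) : Fin 6 → Fin 6 → ℂ)) =
      R' * (Matrix.diagonal fun l => Complex.exp (F.n l * σ)) * F.B.transpose := by
    have hrow (i : Fin 6) : (R' * (Matrix.diagonal fun l => Complex.exp (F.n l * σ)) *
        F.B.transpose) i = F.vec σ (R' i) := by
      funext j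
      rw [Matrix.mul_apply]
      simp only [Matrix.mul_diagonal, vec, Matrix.mulVec, dotProduct, Matrix.transpose_apply]
      exact Finset.sum_congr rfl fun l _ => by ring
    have hRrow (i l : Fin 6) : R' i l = e i * D i l + k i * (Complex.I * D 1 l) := by
      simp [hR', hR, Matrix.diagonal_mul, e]
    funext i
    rw [hrow]
    revert i
    refine Fin.cases ?_ (Fin.cases ?_ fun j => ?_)
    · change F.vec σ (F.base y) = _
      congr 1
      funext l
      rw [hRrow]
      simp [e, k, hD, base]
    · change fderiv ℝ (F.chart T) x (Pi.single 0 1) = _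
      rw [F.fderiv_chart hN hT hx]
      have ht : Fin.tail (Pi.single 0 1 : Fin 5 → ℝ) = 0 := by
        funext j
        simp [Fin.tail]
      have hz : F.chartDeriv T x (Pi.single 0 1) = 0 := by
        funext l
        rw [chartDeriv, ht]
        revert l
        refine Fin.cases (by simp [dbase]) (Fin.cases (by simp [dbase]) fun j => by simp [dbase])
      simp only [hz, vec, ← Matrix.mulVec_smul, ← Matrix.mulVec_add]
      congr 1
      funext l
      rw [hRrow]
      simp [e, k, hD, weight]
      ring
    · change fderiv ℝ (F.chart T) x (Pi.single j.succ 1) = _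
      rw [F.fderiv_chart hN hT hx]
      have ht : Fin.tail (Pi.single j.succ 1 : Fin 5 → ℝ) = Pi.single j 1 := by
        funext i
        simp [Fin.tail, Pi.single_apply]
      have h0 : (Pi.single j.succ 1 : Fin 5 → ℝ) 0 = 0 := by simp
      have hd : F.dbase y (Pi.single j 1) = D j.succ.succ := by
        simp [dbase, hD, Pi.single_apply]
        rfl
      have hD1 (l) : D 1 l = F.n l * slice F.Q y l := rfl
      have he : e j.succ.succ = 1 := by fin_cases j <;> rfl
      have hkj : k j.succ.succ = -Complex.I * (fderiv ℝ T y (Pi.single j 1) : ℝ) := rfl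
      rw [h0, Complex.ofReal_zero, mul_zero, zero_smul, add_zero]
      congr 1
      funext l
      rw [hRrow, chartDeriv, ht, hd, hD1, he, hkj]
      push_cast
      linear_combination ((fderiv ℝ T y (Pi.single j 1) : ℝ) * (F.n l : ℂ) * slice F.Q y l) *
        Complex.I_mul_I
  rw [hM, Matrix.det_mul, Matrix.det_mul, hRdet, hprod, Matrix.det_transpose]
  ring

theorem injective_fderiv_chart (hN : IsOpen N) (hT : ContDiffOn ℝ ∞ T N)
    (hx : x ∈ chartDomain N θ) : Function.Injective (fderiv ℝ (F.chart T) x) := by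
  rw [injective_iff_map_eq_zero]
  intro s hs
  rw [F.fderiv_chart hN hT hx] at hs
  simp only [vec, ← Matrix.mulVec_smul, ← Matrix.mulVec_add] at hs
  have h := F.vec_eq_zero (σ := T (Fin.tail x) + x 0 * Complex.I)
    (ξ := fun l => F.chartDeriv T x s l + Complex.I * s 0 * F.weight (Fin.tail x) l) (by
      rw [← hs, vec]
      congr 1
      funext l
      simp
      ring)
  -- Coordinate `0` of the base point is constantly `1` with weight `1`: its imaginary part detects
  -- `s 0`, and its real part below detects the derivative of `T`.
  have h0 : s 0 = 0 := by
    have := congrArg Complex.im (congrFun h 0)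
    simpa [weight, F.n_zero, slice] using this
  have hl (l) : F.chartDeriv T x s l = 0 := by
    have := congrArg Complex.re (congrFun h l)
    simpa [h0] using this
  have hT0 : fderiv ℝ T (Fin.tail x) (Fin.tail s) = 0 := by
    simpa [chartDeriv, F.n_zero, slice, dbase] using hl 0
  funext i
  revert i
  refine Fin.cases h0 fun j => ?_
  simpa [chartDeriv, hT0, dbase, Fin.tail] using hl j.succ.succ

end

theorem exists_chart {a : ℝ} {u : ℝ → ℝ} (hu : IsPotential 5 a u) {c : ℝ} {p : Fin 6 → ℂ}
    (hp : p ∈ F.orbit u c) (hp0 : (F.B⁻¹.mulVec p) 0 ≠ 0) :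
    ∃ W ψ, IsSpecialChart u (F.orbit u c) (-2 * Complex.I * F.B.det) W ψ ∧ p ∈ ψ '' W := by
  obtain ⟨N, T, hN, hT, hiff⟩ := F.exists_moment_solution hu c
  have hc : ∀ y ∈ N, F.moment u (y, T y) = c := fun y hy => (hiff y _).2 ⟨hy, rfl⟩
  set θ := ((F.B⁻¹.mulVec p) 0).arg with hθ
  -- Turning coordinate `0` by `-θ` moves its value at `p` to the positive real axis, away from the
  -- cut of the argument.
  set g : (Fin 6 → ℂ) → ℂ := fun z => (F.B⁻¹.mulVec z) 0 * Complex.exp (-(θ * Complex.I)) with hg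
  have hcont : Continuous fun z : Fin 6 → ℂ => F.B⁻¹.mulVec z :=
    continuous_const.matrix_mulVec continuous_id
  have hgc : Continuous g := ((continuous_apply 0).comp hcont).mul continuous_const
  set O : Set (Fin 6 → ℂ) := g ⁻¹' Complex.slitPlane
  -- On the chart, coordinate `0` is `e^σ`, so its argument returns the angle, and dividing
  -- coordinate `l` by its `n_l`-th power returns the real slice coordinate.
  set χ : (Fin 6 → ℂ) → Fin 5 → ℝ := fun z => Fin.cons (θ + (g z).arg) fun j : Fin 4 =>
    ((F.B⁻¹.mulVec z) j.succ.succ * (F.B⁻¹.mulVec z) 0 ^ (-F.n j.succ.succ)).re with hχ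
  have hgchart (x : Fin 5 → ℝ) :
      g (F.chart T x) = Complex.exp (T (Fin.tail x) + (x 0 - θ : ℝ) * Complex.I) := by
    simp only [hg, chart, inv_mulVec_vec, F.n_zero, base, slice, Fin.cons_zero]
    rw [Complex.ofReal_one, mul_one, ← Complex.exp_add]
    congr 1
    push_cast
    ring
  have harg (x : Fin 5 → ℝ) (hx : x ∈ chartDomain N θ) : (g (F.chart T x)).arg = x 0 - θ := by
    rw [hgchart, Complex.arg_exp]
    simp only [Complex.add_im, Complex.ofReal_im, zero_add, Complex.im_ofReal_mul, Complex.I_im,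
      mul_one]
    rw [toIocMod_eq_self]
    have := hx.2
    constructor <;> linarith [this.1, this.2]
  have hmaps (z) (hz : z ∈ F.orbit u c) (hzO : z ∈ O) :
      ∃ x ∈ chartDomain N θ, F.chart T x = z := by
    have hgz : g z ≠ 0 := Complex.slitPlane_ne_zero hzO
    set σ : ℂ := Complex.log (g z) + θ * Complex.I
    have hσ : (F.B⁻¹.mulVec z) 0 = Complex.exp σ := by
      rw [Complex.exp_add, Complex.exp_log hgz, hg]
      simp only
      rw [mul_assoc, ← Complex.exp_add]
      simp
    obtain ⟨y, hzy, hm⟩ := F.exists_eq_vec_base hz hσ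
    obtain ⟨hy, ht⟩ := (hiff _ _).1 hm
    have him : σ.im = (g z).arg + θ := by simp [σ, Complex.log_im]
    refine ⟨Fin.cons σ.im y, ⟨hy, ?_⟩, ?_⟩
    · have h1 := Complex.neg_pi_lt_arg (g z)
      have h2 := lt_of_le_of_ne (Complex.arg_le_pi _) (Complex.mem_slitPlane_iff_arg.1 hzO).1
      simp only [Fin.cons_zero, him]
      constructor <;> linarith
    · simp only [chart, Fin.tail_cons, Fin.cons_zero, ← ht, Complex.re_add_im, hzy]
  have hpO : p ∈ O := by
    have : g p = ‖(F.B⁻¹.mulVec p) 0‖ := by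
      have h (w : ℂ) : w * Complex.exp (-(w.arg * Complex.I)) = ‖w‖ := by
        nth_rewrite 1 [← Complex.norm_mul_exp_arg_mul_I w]
        rw [mul_assoc, ← Complex.exp_add]
        simp
      exact h _
    change g p ∈ Complex.slitPlane
    rw [this, Complex.ofReal_mem_slitPlane]
    exact norm_pos_iff.2 hp0
  refine ⟨chartDomain N θ, F.chart T, ⟨⟨isOpen_chartDomain hN θ, F.contDiffOn_chart hT θ,
    fun x hx => F.injective_fderiv_chart hN hT hx, O, χ,
    Complex.isOpen_slitPlane.preimage hgc, ?_, ?_, ?_⟩,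
    fun x hx => F.kahlerForm_chart hu hN hT hc hx, fun x hx => F.det_chart hN hT hx⟩,
    hmaps p hp hpO⟩
  · apply Set.Subset.antisymm
    · rintro _ ⟨x, hx, rfl⟩
      refine ⟨F.vec_base_mem_orbit (by simpa using hc _ hx.1), ?_⟩
      change g (F.chart T x) ∈ Complex.slitPlane
      rw [Complex.mem_slitPlane_iff_arg, harg x hx, hgchart]
      exact ⟨by linarith [hx.2.2], Complex.exp_ne_zero _⟩
    · rintro z ⟨hz, hzO⟩
      exact hmaps z hz hzO
  · refine ContinuousOn.mono (s := O) ?_ Set.inter_subset_right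
    rw [continuousOn_pi]
    refine Fin.cases ?_ fun j => ?_
    · refine continuousOn_const.add fun z hz => ?_
      exact ((Complex.continuousAt_arg hz).comp hgc.continuousAt).continuousWithinAt
    · have h1 : ContinuousOn (fun z => (F.B⁻¹.mulVec z) 0 ^ (-F.n j.succ.succ)) O :=
        ((continuous_apply 0).comp hcont).continuousOn.zpow₀ _ fun z hz =>
          Or.inl (left_ne_zero_of_mul (Complex.slitPlane_ne_zero hz))
      exact Complex.continuous_re.comp_continuousOn
        (((continuous_apply j.succ.succ).comp hcont).continuousOn.mul h1)
  · intro x hx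
    funext i
    revert i
    refine Fin.cases ?_ fun j => ?_
    · simp only [hχ, Fin.cons_zero, harg x hx]
      ring
    · simp only [hχ, Fin.cons_succ, chart, inv_mulVec_vec, F.n_zero]
      have h0 : F.base (Fin.tail x) 0 = 1 := by simp [base, slice]
      have hj : F.base (Fin.tail x) j.succ.succ = (x j.succ : ℝ) := rfl
      rw [h0, hj, Int.cast_one, one_mul, mul_one, ← Complex.exp_int_mul, mul_right_comm,
        ← Complex.exp_add]
      simp

end AdaptedFrame

/-! ### Construction of adapted frames -/

/-- Multiplication by the unipotent `C` clears the first column below the corner and leaves an upper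
triangular matrix. -/
theorem det_arrow {m : ℕ} (α : ℝ) (w g : Fin m → ℝ) :
    Matrix.det (Matrix.of (Fin.cons (Fin.cons α w) fun j => Fin.cons (g j) (Pi.single j 1) :
      Fin (m + 1) → Fin (m + 1) → ℝ)) = α - ∑ j, w j * g j := by
  set A : Matrix (Fin (m + 1)) (Fin (m + 1)) ℝ :=
    Matrix.of (Fin.cons (Fin.cons α w) fun j => Fin.cons (g j) (Pi.single j 1)) with hA
  set C : Matrix (Fin (m + 1)) (Fin (m + 1)) ℝ :=
    Matrix.of (Fin.cons (Fin.cons 1 0) fun j => Fin.cons (-g j) (Pi.single j 1)) with hC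
  have hCdet : C.det = 1 := by
    rw [Matrix.det_of_isLowerTriangular C (by
      intro i j hij
      revert i j
      refine Fin.cases ?_ fun i => ?_
      · refine Fin.cases (fun h => absurd h (lt_irrefl _)) fun j _ => rfl
      · refine Fin.cases (fun h => absurd (OrderDual.toDual_lt_toDual.1 h) (by simp))
          fun j h => ?_
        have : j ≠ i := fun h' => by simp [h'] at h
        simp [hC, this])]
    rw [Fin.prod_univ_succ]
    simp [hC]
  have hACdet : (A * C).det = α - ∑ j, w j * g j := by
    rw [Matrix.det_of_isUpperTriangular (M := A * C) (by
      intro i j hij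
      revert i j
      refine Fin.cases (fun j h => absurd h (by simp)) fun i => ?_
      refine Fin.cases (fun _ => ?_) fun j h => ?_
      · simp [Matrix.mul_apply, Fin.sum_univ_succ, hA, hC, Pi.single_apply]
      · have : j ≠ i := fun h' => by simp [h'] at h
        simp [Matrix.mul_apply, Fin.sum_univ_succ, hA, hC, Pi.single_apply, this])]
    rw [Fin.prod_univ_succ]
    simp [Matrix.mul_apply, Fin.sum_univ_succ, hA, hC, Pi.single_apply]
    ring
  rw [Matrix.det_mul, hCdet, mul_one] at hACdet
  exact hACdet

/-- Expansion along the first column leaves two arrow determinants. Invariance of `Q` makes the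
first `-(1 - Q)`, Euler's relation makes the second `1 + Q`, and their difference is `-2`. -/
theorem det_slice {n : Fin 6 → ℤ} {Q : (Fin 4 → ℝ) → ℝ} {g y : Fin 4 → ℝ} (h0 : n 0 = 1)
    (h1 : n 1 = -1) (euler : ∑ j, y j * g j = 2 * Q y)
    (invariant : ∑ j, n j.succ.succ * y j * g j = 0) :
    Matrix.det (Matrix.of (Fin.cons (slice Q y) (Fin.cons (fun l => n l * slice Q y l)
      fun j => Fin.cons 0 (Fin.cons (-g j) (Pi.single j 1))) : Fin 6 → Fin 6 → ℝ)) = -2 := by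
  have e0 : (Matrix.of (Fin.cons (slice Q y) (Fin.cons (fun l => n l * slice Q y l)
      fun j => Fin.cons 0 (Fin.cons (-g j) (Pi.single j 1))) : Fin 6 → Fin 6 → ℝ)).submatrix
      (Fin.succAbove 0) Fin.succ = Matrix.of (Fin.cons (Fin.cons (-(1 - Q y))
        fun j => n j.succ.succ * y j) fun j => Fin.cons (-g j) (Pi.single j 1)) := by
    funext i j
    revert i j
    refine Fin.cases (Fin.cases ?_ fun j => rfl) fun i => Fin.cases rfl fun j => rfl
    change (n 1 : ℝ) * (1 - Q y) = -(1 - Q y)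
    rw [h1]
    push_cast
    ring
  have e1 : (Matrix.of (Fin.cons (slice Q y) (Fin.cons (fun l => n l * slice Q y l)
      fun j => Fin.cons 0 (Fin.cons (-g j) (Pi.single j 1))) : Fin 6 → Fin 6 → ℝ)).submatrix
      (Fin.succAbove 1) Fin.succ = Matrix.of (Fin.cons (Fin.cons (1 - Q y) y)
        fun j => Fin.cons (-g j) (Pi.single j 1)) := by
    funext i j
    revert i j
    refine Fin.cases (Fin.cases rfl fun j => rfl) fun i => Fin.cases rfl fun j => rfl
  rw [Matrix.det_succ_column_zero, Fin.sum_univ_succ, Fin.sum_univ_succ,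
    Finset.sum_eq_zero fun i _ => by simp, Fin.succ_zero_eq_one, e0, e1, det_arrow, det_arrow]
  simp [slice, h0] at euler invariant ⊢
  linarith

namespace AdaptedFrame

/-- The frame with permuted coordinate vectors. -/
def permute (F : AdaptedFrame) (e : Equiv.Perm (Fin 6)) (hn : ∀ l, F.n (e l) = F.n l)
    (hd : ∀ l, F.d (e l) = F.d l)
    (hQ : ∀ v : Fin 6 → ℝ, v (e.symm 0) * v (e.symm 1) + F.Q (fun j => v (e.symm j.succ.succ)) =
      v 0 * v 1 + F.Q fun j => v j.succ.succ) : AdaptedFrame where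
  B := F.B.submatrix id e
  n := F.n
  d := F.d
  Q := F.Q
  G := F.G
  herm x y := by
    rw [Matrix.submatrix_mulVec_equiv, Matrix.submatrix_mulVec_equiv]
    simp only [Function.comp_id]
    rw [F.herm, ← Equiv.sum_comp e]
    simp [hd]
  d_pos := F.d_pos
  quad ζ hζ v := by
    rw [Matrix.submatrix_mulVec_equiv]
    simp only [Function.comp_id]
    have hn' (l) : F.n (e.symm l) = F.n l := by rw [← hn (e.symm l), e.apply_symm_apply]
    have : ((fun l => ζ ^ F.n l * (v l : ℂ)) ∘ e.symm) =
        fun l => ζ ^ F.n l * ((fun k => v (e.symm k)) l : ℂ) := by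
      funext l
      simp [hn']
    rw [this, ← hQ]
    exact F.quad ζ hζ fun k => v (e.symm k)
  smooth := F.smooth
  hasGrad := F.hasGrad
  n_zero := F.n_zero
  n_sum := F.n_sum
  det := F.det

theorem orbit_permute (F : AdaptedFrame) (e : Equiv.Perm (Fin 6)) (hn hd hQ) (u : ℝ → ℝ) (c : ℝ) :
    (F.permute e hn hd hQ).orbit u c = F.orbit u c := by
  have hn' (l) : F.n (e.symm l) = F.n l := by rw [← hn (e.symm l), e.apply_symm_apply]
  have hB (ζ : ℂ) (v : Fin 6 → ℝ) : ((F.B.submatrix id e).mulVec fun l => ζ ^ F.n l * (v l : ℂ)) =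
      F.B.mulVec fun l => ζ ^ F.n l * (v (e.symm l) : ℂ) := by
    rw [Matrix.submatrix_mulVec_equiv]
    simp only [Function.comp_id]
    congr 1
    funext l
    simp [hn']
  have hsum (ζ : ℂ) (v : Fin 6 → ℝ) :
      ∑ l, F.d l * (F.n l * Complex.normSq (ζ ^ F.n l * (v (e.symm l) : ℂ))) =
        ∑ l, F.d l * (F.n l * Complex.normSq (ζ ^ F.n l * (v l : ℂ))) := by
    rw [← Equiv.sum_comp e]
    simp [hn, hd]
  ext z
  constructor
  · rintro ⟨hq, ζ, hζ, v, hz, hc⟩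
    refine ⟨hq, ζ, hζ, fun l => v (e.symm l), hz.trans (hB ζ v), ?_⟩
    rw [← hc]
    exact congrArg _ (hsum ζ v)
  · rintro ⟨hq, ζ, hζ, v, hz, hc⟩
    refine ⟨hq, ζ, hζ, fun l => v (e l), ?_, ?_⟩
    · refine hz.trans ?_
      rw [show (F.permute e hn hd hQ).B = F.B.submatrix id e from rfl,
        show (F.permute e hn hd hQ).n = F.n from rfl, hB]
      simp
    · rw [← hc]
      refine congrArg _ ((hsum ζ _).symm.trans ?_)
      simp

/-- Evenness of `e` keeps `det B`, hence the determinant of the charts. Without it the phases of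
charts around different points could differ by a sign. -/
theorem exists_chart_permute (F : AdaptedFrame) (e : Equiv.Perm (Fin 6))
    (hn : ∀ l, F.n (e l) = F.n l) (hd : ∀ l, F.d (e l) = F.d l)
    (hQ : ∀ v : Fin 6 → ℝ, v (e.symm 0) * v (e.symm 1) + F.Q (fun j => v (e.symm j.succ.succ)) =
      v 0 * v 1 + F.Q fun j => v j.succ.succ)
    (he : Equiv.Perm.sign e = 1) {a : ℝ} {u : ℝ → ℝ} (hu : IsPotential 5 a u) {c : ℝ}
    {p : Fin 6 → ℂ} (hp : p ∈ F.orbit u c) (hp0 : (F.B⁻¹.mulVec p) (e 0) ≠ 0) :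
    ∃ W ψ, IsSpecialChart u (F.orbit u c) (-2 * Complex.I * F.B.det) W ψ ∧ p ∈ ψ '' W := by
  have h := (F.permute e hn hd hQ).exists_chart hu (c := c) (p := p)
  rw [F.orbit_permute] at h
  have hdet : (F.permute e hn hd hQ).B.det = F.B.det := by
    change (F.B.submatrix id e).det = _
    rw [Matrix.det_permute', he]
    simp
  rw [hdet] at h
  refine h hp ?_
  have hinv : (F.permute e hn hd hQ).B⁻¹.mulVec p = (F.B⁻¹.mulVec p) ∘ e := by
    change ((F.B.submatrix id e)⁻¹).mulVec p = _
    have := Matrix.inv_submatrix_equiv F.B (Equiv.refl _) e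
    rw [show (F.B.submatrix id e)⁻¹ = F.B⁻¹.submatrix e id from this]
    rfl
  rw [hinv]
  exact hp0

/-- The real coordinates of a point of the orbit satisfy the equation of the quadric, and they are
nonzero only where the complex ones are. -/
theorem exists_real_coordinates (F : AdaptedFrame) {u : ℝ → ℝ} {c : ℝ} {p : Fin 6 → ℂ}
    (hp : p ∈ F.orbit u c) : ∃ v : Fin 6 → ℝ, (v 0 * v 1 + F.Q fun j => v j.succ.succ) = 1 ∧
      ∀ l, v l ≠ 0 → (F.B⁻¹.mulVec p) l ≠ 0 := by
  obtain ⟨hq, ζ, hζ, v, rfl, -⟩ := hp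
  refine ⟨v, ?_, fun l hl => ?_⟩
  · have h := F.quad ζ hζ v
    rw [show ∑ i, (F.B.mulVec fun l => ζ ^ F.n l * (v l : ℂ)) i ^ 2 = 1 from hq] at h
    exact_mod_cast h.symm
  · rw [Matrix.mulVec_mulVec, Matrix.nonsing_inv_mul _ F.isUnit_det, Matrix.one_mulVec]
    exact mul_ne_zero (zpow_ne_zero _ hζ) (by exact_mod_cast hl)

end AdaptedFrame

/-! ### The two frames -/

theorem block_herm (a b a' b' : ℂ) :
    (a + b) / 2 * star ((a' + b') / 2) +
      -Complex.I / 2 * (a - b) * star (-Complex.I / 2 * (a' - b')) =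
      1 / 2 * (a * star a') + 1 / 2 * (b * star b') := by
  simp only [Complex.star_def, map_mul, map_div₀, map_add, map_sub, map_neg, Complex.conj_I,
    Complex.conj_ofNat]
  linear_combination (-(a - b) * ((starRingEnd ℂ) a' - (starRingEnd ℂ) b') / 4) * Complex.I_sq

theorem block_sq (a b : ℂ) : ((a + b) / 2) ^ 2 + (-Complex.I / 2 * (a - b)) ^ 2 = a * b := by
  linear_combination ((a - b) ^ 2 / 4) * Complex.I_sq

/-- The coordinate vectors for the conormal bundle of `S²`. -/
def basis₁ : Matrix (Fin 6) (Fin 6) ℂ :=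
  !![1 / 2, 1 / 2, 0, 0, 0, 0;
     -Complex.I / 2, Complex.I / 2, 0, 0, 0, 0;
     0, 0, 1 / 2, 1 / 2, 0, 0;
     0, 0, -Complex.I / 2, Complex.I / 2, 0, 0;
     0, 0, 0, 0, 1 / 2, 1 / 2;
     0, 0, 0, 0, -Complex.I / 2, Complex.I / 2]

/-- The coordinate vectors for the conormal bundle of `S¹`. -/
def basis₂ : Matrix (Fin 6) (Fin 6) ℂ :=
  !![1 / 2, 1 / 2, 0, 0, 0, 0;
     -Complex.I / 2, Complex.I / 2, 0, 0, 0, 0;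
     0, 0, 1 / 2, 1 / 2, 0, 0;
     0, 0, -Complex.I / 2, Complex.I / 2, 0, 0;
     0, 0, 0, 0, Complex.I, 0;
     0, 0, 0, 0, 0, Complex.I]

theorem basis₁_mulVec (x : Fin 6 → ℂ) : basis₁.mulVec x =
    ![(x 0 + x 1) / 2, -Complex.I / 2 * (x 0 - x 1), (x 2 + x 3) / 2,
      -Complex.I / 2 * (x 2 - x 3), (x 4 + x 5) / 2, -Complex.I / 2 * (x 4 - x 5)] := by
  funext i
  fin_cases i <;> simp [basis₁, Matrix.mulVec, dotProduct, Fin.sum_univ_six] <;> ring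

theorem basis₂_mulVec (x : Fin 6 → ℂ) : basis₂.mulVec x =
    ![(x 0 + x 1) / 2, -Complex.I / 2 * (x 0 - x 1), (x 2 + x 3) / 2,
      -Complex.I / 2 * (x 2 - x 3), Complex.I * x 4, Complex.I * x 5] := by
  funext i
  fin_cases i <;> simp [basis₂, Matrix.mulVec, dotProduct, Fin.sum_univ_six] <;> ring

/-- The frame adapted to the conormal bundle of `S²`. -/
def frame₁ : AdaptedFrame where
  B := basis₁
  n := ![1, -1, 1, -1, 1, -1]
  d := fun _ => 1 / 2
  Q y := y 0 * y 1 + y 2 * y 3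
  G y := ![y 1, y 0, y 3, y 2]
  herm x y := by
    rw [basis₁_mulVec, basis₁_mulVec]
    have h1 := block_herm (x 0) (x 1) (y 0) (y 1)
    have h2 := block_herm (x 2) (x 3) (y 2) (y 3)
    have h3 := block_herm (x 4) (x 5) (y 4) (y 5)
    simp only [dotProduct, Fin.sum_univ_six, Pi.star_apply]
    push_cast
    linear_combination h1 + h2 + h3
  d_pos _ := by norm_num
  quad ζ hζ v := by
    rw [basis₁_mulVec]
    have h1 := block_sq (ζ * v 0) (ζ⁻¹ * v 1)
    have h2 := block_sq (ζ * v 2) (ζ⁻¹ * v 3)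
    have h3 := block_sq (ζ * v 4) (ζ⁻¹ * v 5)
    have hi : ζ * ζ⁻¹ = 1 := mul_inv_cancel₀ hζ
    simp only [Fin.sum_univ_six, Matrix.cons_val, zpow_one, zpow_neg]
    have e : ((v 0 * v 1 + (v 2 * v 3 + v 4 * v 5) : ℝ) : ℂ) =
      v 0 * v 1 + v 2 * v 3 + v 4 * v 5 := by push_cast; ring
    refine Eq.trans ?_ e.symm
    linear_combination h1 + h2 + h3 + ((v 0 : ℂ) * v 1 + v 2 * v 3 + v 4 * v 5) * hi
  smooth := by fun_prop
  hasGrad y := by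
    have hp (j : Fin 4) : HasFDerivAt (fun y : Fin 4 → ℝ => y j)
        (ContinuousLinearMap.proj (R := ℝ) (φ := fun _ : Fin 4 => ℝ) j) y :=
      (ContinuousLinearMap.proj (R := ℝ) (φ := fun _ : Fin 4 => ℝ) j).hasFDerivAt
    refine (((hp 0).mul (hp 1)).add ((hp 2).mul (hp 3))).congr_fderiv ?_
    ext w
    simp [Fin.sum_univ_four]
    ring
  n_zero := rfl
  n_sum := by decide
  det y := by
    refine det_slice rfl rfl ?_ ?_
    · simp [Fin.sum_univ_four]
      ring
    · rw [Fin.sum_univ_four]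
      simp
      ring

/-- The frame adapted to the conormal bundle of `S¹`. -/
def frame₂ : AdaptedFrame where
  B := basis₂
  n := ![1, -1, 1, -1, 0, 0]
  d := ![1 / 2, 1 / 2, 1 / 2, 1 / 2, 1, 1]
  Q y := y 0 * y 1 - (y 2 * y 2 + y 3 * y 3)
  G y := ![y 1, y 0, -2 * y 2, -2 * y 3]
  herm x y := by
    rw [basis₂_mulVec, basis₂_mulVec]
    have h1 := block_herm (x 0) (x 1) (y 0) (y 1)
    have h2 := block_herm (x 2) (x 3) (y 2) (y 3)
    have h3 (x y : ℂ) : Complex.I * x * star (Complex.I * y) = x * star y := by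
      simp only [Complex.star_def, map_mul, Complex.conj_I]
      linear_combination (-x * (starRingEnd ℂ) y) * Complex.I_sq
    simp only [dotProduct, Fin.sum_univ_six, Pi.star_apply]
    simp only [Matrix.cons_val]
    push_cast
    linear_combination h1 + h2 + h3 (x 4) (y 4) + h3 (x 5) (y 5)
  d_pos l := by fin_cases l <;> simp
  quad ζ hζ v := by
    rw [basis₂_mulVec]
    have h1 := block_sq (ζ * v 0) (ζ⁻¹ * v 1)
    have h2 := block_sq (ζ * v 2) (ζ⁻¹ * v 3)
    have hi : ζ * ζ⁻¹ = 1 := mul_inv_cancel₀ hζ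
    simp only [Fin.sum_univ_six, Matrix.cons_val, zpow_one, zpow_neg, zpow_zero]
    have e : ((v 0 * v 1 + (v 2 * v 3 - (v 4 * v 4 + v 5 * v 5)) : ℝ) : ℂ) =
      v 0 * v 1 + v 2 * v 3 - (v 4 * v 4 + v 5 * v 5) := by push_cast; ring
    refine Eq.trans ?_ e.symm
    linear_combination h1 + h2 + ((v 0 : ℂ) * v 1 + v 2 * v 3) * hi +
      ((v 4 : ℂ) ^ 2 + (v 5 : ℂ) ^ 2) * Complex.I_sq
  smooth := by fun_prop
  hasGrad y := by
    have hp (j : Fin 4) : HasFDerivAt (fun y : Fin 4 → ℝ => y j)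
        (ContinuousLinearMap.proj (R := ℝ) (φ := fun _ : Fin 4 => ℝ) j) y :=
      (ContinuousLinearMap.proj (R := ℝ) (φ := fun _ : Fin 4 => ℝ) j).hasFDerivAt
    refine (((hp 0).mul (hp 1)).sub
      (((hp 2).mul (hp 2)).add ((hp 3).mul (hp 3)))).congr_fderiv ?_
    ext w
    simp [Fin.sum_univ_four]
    ring
  n_zero := rfl
  n_sum := by decide
  det y := by
    refine det_slice rfl rfl ?_ ?_
    · simp [Fin.sum_univ_four]
      ring
    · rw [Fin.sum_univ_four]
      simp
      ring

theorem sign_swap_mul_swap {i j k l : Fin 6} (h : i ≠ j) (h' : k ≠ l) :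
    Equiv.Perm.sign (Equiv.swap i j * Equiv.swap k l) = 1 := by
  rw [Equiv.Perm.sign_mul, Equiv.Perm.sign_swap h, Equiv.Perm.sign_swap h']
  rfl

theorem exists_chart_frame₁ {a : ℝ} {u : ℝ → ℝ} (hu : IsPotential 5 a u) {c : ℝ}
    {p : Fin 6 → ℂ} (hp : p ∈ frame₁.orbit u c) :
    ∃ W ψ, IsSpecialChart u (frame₁.orbit u c) (-2 * Complex.I * frame₁.B.det) W ψ ∧
      p ∈ ψ '' W := by
  obtain ⟨v, hv, hne⟩ := frame₁.exists_real_coordinates hp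
  have hv' : v 0 * v 1 + (v 2 * v 3 + v 4 * v 5) = 1 := hv
  by_cases h0 : v 0 = 0
  · by_cases h2 : v 2 = 0
    · refine frame₁.exists_chart_permute (Equiv.swap 0 4 * Equiv.swap 1 5) (by decide)
        (fun _ => rfl) (fun w => ?_) (sign_swap_mul_swap (by decide) (by decide)) hu hp (hne 4 ?_)
      · change w 4 * w 5 + (w 2 * w 3 + w 0 * w 1) = w 0 * w 1 + (w 2 * w 3 + w 4 * w 5)
        ring
      · rintro h4
        -- If `v 0 = v 2 = v 4 = 0`, every product in the equation of the quadric vanishes.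
        simp [h0, h2, h4] at hv'
    · refine frame₁.exists_chart_permute (Equiv.swap 0 2 * Equiv.swap 1 3) (by decide)
        (fun _ => rfl) (fun w => ?_) (sign_swap_mul_swap (by decide) (by decide)) hu hp (hne 2 h2)
      change w 2 * w 3 + (w 0 * w 1 + w 4 * w 5) = w 0 * w 1 + (w 2 * w 3 + w 4 * w 5)
      ring
  · exact frame₁.exists_chart hu hp (hne 0 h0)

theorem exists_chart_frame₂ {a : ℝ} {u : ℝ → ℝ} (hu : IsPotential 5 a u) {c : ℝ}
    {p : Fin 6 → ℂ} (hp : p ∈ frame₂.orbit u c) :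
    ∃ W ψ, IsSpecialChart u (frame₂.orbit u c) (-2 * Complex.I * frame₂.B.det) W ψ ∧
      p ∈ ψ '' W := by
  obtain ⟨v, hv, hne⟩ := frame₂.exists_real_coordinates hp
  have hv' : v 0 * v 1 + (v 2 * v 3 - (v 4 * v 4 + v 5 * v 5)) = 1 := hv
  by_cases h0 : v 0 = 0
  · refine frame₂.exists_chart_permute (Equiv.swap 0 2 * Equiv.swap 1 3) (by decide)
      (fun l => by fin_cases l <;> rfl) (fun w => ?_)
      (sign_swap_mul_swap (by decide) (by decide)) hu hp (hne 2 ?_)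
    · change w 2 * w 3 + (w 0 * w 1 - (w 4 * w 4 + w 5 * w 5)) =
        w 0 * w 1 + (w 2 * w 3 - (w 4 * w 4 + w 5 * w 5))
      ring
    · intro h2
      rw [h0, h2] at hv'
      -- With `v 0 = v 2 = 0` the equation would read `-(v 4)² - (v 5)² = 1`.
      nlinarith [mul_self_nonneg (v 4), mul_self_nonneg (v 5)]
  · exact frame₂.exists_chart hu hp (hne 0 h0)

/-! ### Szőke's map and the circle action -/

theorem szoke_eq {n : ℕ} (p : (Fin (n + 1) → ℝ) × (Fin (n + 1) → ℝ)) :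
    ∃ P R : ℝ, P ^ 2 - R ^ 2 * (p.2 ⬝ᵥ p.2) = 1 ∧
      szoke p = fun i => (P : ℂ) * p.1 i + Complex.I * (R * p.2 i) := by
  refine ⟨Real.cosh (euclNorm p.2), Real.sinh (euclNorm p.2) / euclNorm p.2, ?_, ?_⟩
  · have h : p.2 ⬝ᵥ p.2 = euclNorm p.2 ^ 2 :=
      (Real.sq_sqrt (Finset.sum_nonneg fun i _ => mul_self_nonneg (p.2 i))).symm
    rw [h, Real.cosh_sq]
    by_cases h0 : euclNorm p.2 = 0
    · simp [h0]
    · field_simp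
      ring
  · funext i
    simp only [szoke]
    push_cast
    ring

/-- This inverts Szőke's map: `‖ξ‖ = arsinh ‖q‖`, and then `cosh ‖ξ‖ = ‖p‖`. -/
theorem exists_szoke_eq {n : ℕ} {p q : Fin (n + 1) → ℝ} (h : p ⬝ᵥ p - q ⬝ᵥ q = 1) :
    ∃ α β : ℝ, (α • p) ⬝ᵥ (α • p) = 1 ∧
      szoke (α • p, β • q) = fun i => (p i : ℂ) + Complex.I * q i := by
  have hq : 0 ≤ q ⬝ᵥ q := Finset.sum_nonneg fun i _ => mul_self_nonneg (q i)
  have hp : 0 < p ⬝ᵥ p := by linarith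
  set r := √(q ⬝ᵥ q) with hr
  set t := Real.arsinh r with ht
  have hr0 : 0 ≤ r := Real.sqrt_nonneg _
  have ht0 : 0 ≤ t := Real.arsinh_nonneg_iff.2 hr0
  have hr2 : r ^ 2 = q ⬝ᵥ q := Real.sq_sqrt hq
  have hcosh : Real.cosh t = √(p ⬝ᵥ p) := by
    rw [ht, Real.cosh_arsinh, hr2]
    congr 1
    linarith
  have hsinh : Real.sinh t = r := Real.sinh_arsinh r
  have hsp : √(p ⬝ᵥ p) ≠ 0 := (Real.sqrt_pos.2 hp).ne'
  refine ⟨(√(p ⬝ᵥ p))⁻¹, t / r, ?_, ?_⟩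
  -- For `q = 0` the factor `t / r` is `0 / 0 = 0`, which is harmless because it multiplies the zero
  -- vector.
  · rw [smul_dotProduct, dotProduct_smul, smul_eq_mul, smul_eq_mul, ← mul_assoc, ← mul_inv,
      Real.mul_self_sqrt hp.le, inv_mul_cancel₀ hp.ne']
  · rcases eq_or_ne r 0 with h0 | h0
    · have hq0 : q = 0 := by
        rw [← dotProduct_self_eq_zero, ← hr2, h0]
        norm_num
      funext i
      have hpp : √(p ⬝ᵥ p) = 1 := by
        rw [hq0] at h
        simp at h
        simp [h]
      simp [szoke, hq0, euclNorm, hpp]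
    · have htp : t ≠ 0 := fun h => h0 (by rw [← hsinh, h, Real.sinh_zero])
      have hn : euclNorm ((t / r) • q) = t := by
        rw [euclNorm, smul_dotProduct, dotProduct_smul, smul_eq_mul, smul_eq_mul, ← hr2,
          show t / r * (t / r * r ^ 2) = t ^ 2 by field_simp, Real.sqrt_sq ht0]
      funext i
      simp only [szoke, hn, hcosh, hsinh, Pi.smul_apply, smul_eq_mul]
      congr 2
      · rw [← mul_assoc, mul_inv_cancel₀ hsp, one_mul]
      · congr 1
        field_simp

/-- The action of `diag(h, h, h)` for the plane rotation `h` with cosine `c` and sine `s`. -/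
def rot {K : Type*} [CommRing K] (c s : K) (x : Fin 6 → K) : Fin 6 → K :=
  ![c * x 0 - s * x 1, s * x 0 + c * x 1, c * x 2 - s * x 3, s * x 2 + c * x 3,
    c * x 4 - s * x 5, s * x 4 + c * x 5]

theorem mem_hopfOrbit_iff {V : Set ((Fin 6 → ℝ) × (Fin 6 → ℝ))}
    {q : (Fin 6 → ℝ) × (Fin 6 → ℝ)} : q ∈ hopfOrbit V ↔
      ∃ c s : ℝ, c ^ 2 + s ^ 2 = 1 ∧ ∃ p ∈ V, q = (rot c s p.1, rot c s p.2) := by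
  have key (c s : ℝ) (x : Fin 6 → ℝ) : (blockDiag !![c, -s; s, c]).mulVec x = rot c s x := by
    funext i
    fin_cases i <;> simp [blockDiag, rot, Matrix.mulVec, dotProduct, Fin.sum_univ_six] <;> ring
  constructor
  · rintro ⟨_, ⟨h, hh, rfl⟩, p, hp, rfl⟩
    obtain ⟨h1, h2, h3⟩ := Matrix.mem_specialOrthogonalGroup_fin_two_iff.1 hh
    have e : h = !![h 0 0, -h 1 0; h 1 0, h 0 0] := by
      ext i j
      fin_cases i <;> fin_cases j <;> simp [h1, h2]
    refine ⟨h 0 0, h 1 0, by rw [← h3, h2]; ring, p, hp, ?_⟩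
    rw [← key, ← key, ← e]
  · rintro ⟨c, s, h, p, hp, rfl⟩
    refine ⟨_, ⟨!![c, -s; s, c], ?_, rfl⟩, p, hp, by rw [key, key]⟩
    rw [Matrix.of_mem_specialOrthogonalGroup_fin_two_iff]
    exact ⟨rfl, rfl, by rw [← h]; ring⟩

theorem rot_dotProduct_rot {c s : ℝ} (h : c ^ 2 + s ^ 2 = 1) (x y : Fin 6 → ℝ) :
    rot c s x ⬝ᵥ rot c s y = x ⬝ᵥ y := by
  simp [rot, dotProduct, Fin.sum_univ_six]
  linear_combination (x 0 * y 0 + x 1 * y 1 + x 2 * y 2 + x 3 * y 3 + x 4 * y 4 + x 5 * y 5) * h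

theorem rSq_rot {c s : ℝ} (h : c ^ 2 + s ^ 2 = 1) (z : Fin 6 → ℂ) :
    rSq (rot (c : ℂ) s z) = rSq z := by
  simp [rot, rSq, Fin.sum_univ_six, Complex.normSq_apply]
  linear_combination ((z 0).re * (z 0).re + (z 0).im * (z 0).im + (z 1).re * (z 1).re +
    (z 1).im * (z 1).im + (z 2).re * (z 2).re + (z 2).im * (z 2).im + (z 3).re * (z 3).re +
    (z 3).im * (z 3).im + (z 4).re * (z 4).re + (z 4).im * (z 4).im + (z 5).re * (z 5).re +
    (z 5).im * (z 5).im) * h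

theorem szoke_rot {c s : ℝ} (h : c ^ 2 + s ^ 2 = 1) (x ξ : Fin 6 → ℝ) :
    szoke (rot c s x, rot c s ξ) = rot (c : ℂ) s (szoke (x, ξ)) := by
  have hn : euclNorm (rot c s ξ) = euclNorm ξ := by rw [euclNorm, rot_dotProduct_rot h, euclNorm]
  funext i
  simp only [szoke, hn]
  fin_cases i <;> simp [rot, szoke] <;> ring

theorem hopfOrbit_subset_cotangentSphere {V : Set ((Fin 6 → ℝ) × (Fin 6 → ℝ))}
    (hV : V ⊆ cotangentSphere 5) : hopfOrbit V ⊆ cotangentSphere 5 := by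
  intro q hq
  obtain ⟨c, s, h, p, hp, rfl⟩ := mem_hopfOrbit_iff.1 hq
  obtain ⟨h1, h2⟩ := hV hp
  refine ⟨?_, ?_⟩
  · rw [euclNorm, rot_dotProduct_rot h]
    exact h1
  · rw [rot_dotProduct_rot h]
    exact h2

theorem L₁_subset_cotangentSphere : L₁ ⊆ cotangentSphere 5 := by
  rintro _ ⟨x₁, x₃, x₅, ξ₂, ξ₄, ξ₆, h, rfl⟩
  refine ⟨?_, ?_⟩
  · rw [euclNorm, Real.sqrt_eq_one]
    simp [dotProduct, Fin.sum_univ_six]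
    linear_combination h
  · simp [dotProduct, Fin.sum_univ_six]

theorem L₂_subset_cotangentSphere : L₂ ⊆ cotangentSphere 5 := by
  rintro _ ⟨x₁, x₃, ξ₂, ξ₄, ξ₅, ξ₆, h, rfl⟩
  refine ⟨?_, ?_⟩
  · rw [euclNorm, Real.sqrt_eq_one]
    simp [dotProduct, Fin.sum_univ_six]
    linear_combination h
  · simp [dotProduct, Fin.sum_univ_six]

/-! ### The moment map -/

/-- The generator `ξ₁₂ + ξ₃₄ + ξ₅₆` of the Lie algebra of the circle group. -/
def hopfGenerator : hopfLieAlgebra :=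
  ⟨xi 0 1 + xi 2 3 + xi 4 5, Submodule.mem_span_singleton_self _⟩

/-- The inner product of `I z` with the fundamental vector field at `z`. -/
def rotationPairing (z : Fin 6 → ℂ) : ℝ :=
  2 * ((z 0 * star (z 1)).im + (z 2 * star (z 3)).im + (z 4 * star (z 5)).im)

theorem momentMap_hopfGenerator (u : ℝ → ℝ) (z : Fin 6 → ℂ) :
    momentMap u z hopfGenerator = deriv u (rSq z) * rotationPairing z := by
  have h : (((hopfGenerator : Matrix (Fin 6) (Fin 6) ℝ)).map Complex.ofReal).mulVec z =
      ![-z 1, z 0, -z 3, z 2, -z 5, z 4] := by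
    funext i
    fin_cases i <;>
      simp [hopfGenerator, xi, Matrix.mulVec, dotProduct, Fin.sum_univ_six, Matrix.single_apply]
  change deriv u (rSq z) * realInner (Complex.I • z)
    ((((hopfGenerator : Matrix (Fin 6) (Fin 6) ℝ)).map Complex.ofReal).mulVec z) = _
  rw [h]
  congr 1
  simp [realInner, rotationPairing, Fin.sum_univ_six]
  ring

/-- The Lie algebra is a line, so a functional is determined by its value on the generator. -/
theorem momentMap_eq_iff {u : ℝ → ℝ} {z : Fin 6 → ℂ} {c : Module.Dual ℝ hopfLieAlgebra} :
    momentMap u z = c ↔ deriv u (rSq z) * rotationPairing z = c hopfGenerator := by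
  rw [← momentMap_hopfGenerator]
  refine ⟨fun h => by rw [h], fun h => ?_⟩
  ext ⟨X, hX⟩
  obtain ⟨t, rfl⟩ := Submodule.mem_span_singleton.1 hX
  have : (⟨t • (xi 0 1 + xi 2 3 + xi 4 5), hX⟩ : hopfLieAlgebra) = t • hopfGenerator := rfl
  rw [this, map_smul, map_smul, h]

/-! ### The orbits -/

/-- The modulus `ρ = |ζ|` can be moved into the real vector as `ρ^{n_l} v_l`, so the complexified
group sweeps out the same set as the circle. -/
theorem AdaptedFrame.mem_orbit_iff (F : AdaptedFrame) {u : ℝ → ℝ} {k : ℝ} {z : Fin 6 → ℂ} :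
    z ∈ F.orbit u k ↔ ∃ c s : ℝ, c ^ 2 + s ^ 2 = 1 ∧ ∃ v : Fin 6 → ℝ,
      (v 0 * v 1 + F.Q fun j => v j.succ.succ) = 1 ∧
      (z = F.B.mulVec fun l => ((c : ℂ) + s * Complex.I) ^ F.n l * (v l : ℂ)) ∧
      deriv u (rSq z) * ∑ l, F.d l * (F.n l * v l ^ 2) = k := by
  have hnorm (ζ : ℂ) (hζ : Complex.normSq ζ = 1) (l : Fin 6) (v : ℝ) :
      Complex.normSq (ζ ^ F.n l * (v : ℂ)) = v ^ 2 := by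
    rw [Complex.normSq_mul, map_zpow₀, hζ, one_zpow, Complex.normSq_ofReal, one_mul, sq]
  have hns (c s : ℝ) (h : c ^ 2 + s ^ 2 = 1) : Complex.normSq ((c : ℂ) + s * Complex.I) = 1 := by
    rw [Complex.normSq_add_mul_I, h]
  constructor
  · rintro ⟨hq, ζ, hζ, v, hz, hk⟩
    have hr : 0 < ‖ζ‖ := norm_pos_iff.2 hζ
    set ρ := ‖ζ‖
    have hrC : (ρ : ℂ) ≠ 0 := by exact_mod_cast hr.ne'
    have hcs : (ζ.re / ρ) ^ 2 + (ζ.im / ρ) ^ 2 = 1 := by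
      have : ρ ^ 2 = ζ.re ^ 2 + ζ.im ^ 2 := by
        rw [← Complex.normSq_eq_norm_sq, Complex.normSq_apply]
        ring
      field_simp
      linarith
    have hζρ : ζ = ρ * (((ζ.re / ρ : ℝ) : ℂ) + (ζ.im / ρ : ℝ) * Complex.I) := by
      push_cast
      field_simp
      exact (Complex.re_add_im ζ).symm
    have hx (l) : ζ ^ F.n l * (v l : ℂ) = (((ζ.re / ρ : ℝ) : ℂ) + (ζ.im / ρ : ℝ) * Complex.I) ^
        F.n l * ((ρ ^ F.n l * v l : ℝ) : ℂ) := by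
      conv_lhs => rw [hζρ, mul_zpow]
      push_cast
      ring
    refine ⟨_, _, hcs, fun l => ρ ^ F.n l * v l, ?_, ?_, ?_⟩
    · have h1 := F.quad ζ hζ v
      have h2 := F.quad (((ζ.re / ρ : ℝ) : ℂ) + (ζ.im / ρ : ℝ) * Complex.I)
        (fun h0 => hζ (by rw [hζρ, h0, mul_zero])) fun l => ρ ^ F.n l * v l
      simp only [← hx] at h2
      rw [← hz, show ∑ i, z i ^ 2 = 1 from hq] at h2
      exact_mod_cast h2.symm
    · simp only [← hx]
      exact hz
    · rw [← hk]
      simp only [hx, hnorm _ (hns _ _ hcs)]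
  · rintro ⟨c, s, hcs, v, hv, hz, hk⟩
    have h0 : (c : ℂ) + s * Complex.I ≠ 0 := Complex.normSq_pos.1 (by rw [hns c s hcs]; simp)
    refine ⟨?_, _, h0, v, hz, ?_⟩
    · have h1 := F.quad _ h0 v
      rw [← hz, hv] at h1
      exact h1.trans (by simp)
    · simpa only [hnorm _ (hns _ _ hcs)] using hk

/-- A criterion for the image in the quadric of a circle orbit of a level set to be the orbit
defined by an adapted frame. -/
theorem szoke_image_eq_orbit (F : AdaptedFrame) {L : Set ((Fin 6 → ℝ) × (Fin 6 → ℝ))}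
    (hL : ∀ p ∈ L, ∃ v : Fin 6 → ℝ, (v 0 * v 1 + F.Q fun j => v j.succ.succ) = 1 ∧
      szoke p = F.B.mulVec fun l => (v l : ℂ))
    (hL' : ∀ v : Fin 6 → ℝ, (v 0 * v 1 + F.Q fun j => v j.succ.succ) = 1 →
      ∃ p ∈ L, szoke p = F.B.mulVec fun l => (v l : ℂ))
    (hpair : ∀ v : Fin 6 → ℝ, rotationPairing (F.B.mulVec fun l => (v l : ℂ)) =
      ∑ l, F.d l * (F.n l * v l ^ 2))
    (hrot : ∀ (c s : ℝ), c ^ 2 + s ^ 2 = 1 → ∀ v : Fin 6 → ℝ, ∃ w : Fin 6 → ℝ,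
      (w 0 * w 1 + F.Q fun j => w j.succ.succ) = v 0 * v 1 + F.Q (fun j => v j.succ.succ) ∧
      ∑ l, F.d l * (F.n l * w l ^ 2) = ∑ l, F.d l * (F.n l * v l ^ 2) ∧
      rot (c : ℂ) s (F.B.mulVec fun l => (v l : ℂ)) =
        F.B.mulVec fun l => ((c : ℂ) + s * Complex.I) ^ F.n l * (w l : ℂ))
    (hrot' : ∀ (c s : ℝ), c ^ 2 + s ^ 2 = 1 → ∀ w : Fin 6 → ℝ, ∃ v : Fin 6 → ℝ,
      (v 0 * v 1 + F.Q fun j => v j.succ.succ) = w 0 * w 1 + F.Q (fun j => w j.succ.succ) ∧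
      ∑ l, F.d l * (F.n l * v l ^ 2) = ∑ l, F.d l * (F.n l * w l ^ 2) ∧
      rot (c : ℂ) s (F.B.mulVec fun l => (v l : ℂ)) =
        F.B.mulVec fun l => ((c : ℂ) + s * Complex.I) ^ F.n l * (w l : ℂ))
    (u : ℝ → ℝ) (c : Module.Dual ℝ hopfLieAlgebra) :
    szoke '' hopfOrbit (levelSet u L c) = F.orbit u (c hopfGenerator) := by
  ext z
  rw [AdaptedFrame.mem_orbit_iff]
  constructor
  · rintro ⟨q, hq, rfl⟩
    obtain ⟨k, s, h, p, ⟨hpL, hpc⟩, rfl⟩ := mem_hopfOrbit_iff.1 hq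
    obtain ⟨v, hv, hz⟩ := hL p hpL
    obtain ⟨w, hw, hw', hwr⟩ := hrot k s h v
    refine ⟨k, s, h, w, hw.trans hv, ?_, ?_⟩
    · rw [szoke_rot h, Prod.mk.eta, hz, hwr]
    · rw [szoke_rot h, Prod.mk.eta, rSq_rot h, hw', ← hpair, ← hz]
      exact momentMap_eq_iff.1 hpc
  · rintro ⟨k, s, h, w, hw, hz, hk⟩
    obtain ⟨v, hv, hv', hvr⟩ := hrot' k s h w
    obtain ⟨p, hp, hpv⟩ := hL' v (hv.trans hw)
    have hzp : szoke (rot k s p.1, rot k s p.2) = z := by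
      rw [szoke_rot h, Prod.mk.eta, hpv, hvr, hz]
    refine ⟨_, mem_hopfOrbit_iff.2 ⟨k, s, h, p, ⟨hp, momentMap_eq_iff.2 ?_⟩, rfl⟩, hzp⟩
    rw [← hk, ← hzp, szoke_rot h, Prod.mk.eta, rSq_rot h, ← hv', ← hpair, hpv]

theorem inv_add_mul_I {c s : ℝ} (h : c ^ 2 + s ^ 2 = 1) :
    ((c : ℂ) + s * Complex.I)⁻¹ = c - s * Complex.I := by
  have hC : (c : ℂ) ^ 2 + (s : ℂ) ^ 2 = 1 := by exact_mod_cast h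
  refine inv_eq_of_mul_eq_one_right ?_
  linear_combination hC - (s : ℂ) ^ 2 * Complex.I_sq

theorem szoke_image_orbit₁ (u : ℝ → ℝ) (c : Module.Dual ℝ hopfLieAlgebra) :
    szoke '' hopfOrbit (levelSet u L₁ c) = frame₁.orbit u (c hopfGenerator) := by
  have hrot (c s : ℝ) (h : c ^ 2 + s ^ 2 = 1) (v : Fin 6 → ℝ) :
      rot (c : ℂ) s (frame₁.B.mulVec fun l => (v l : ℂ)) =
        frame₁.B.mulVec fun l => ((c : ℂ) + s * Complex.I) ^ frame₁.n l * (v l : ℂ) := by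
    change rot (c : ℂ) s (basis₁.mulVec _) = basis₁.mulVec _
    rw [basis₁_mulVec, basis₁_mulVec]
    funext i
    fin_cases i <;> simp [rot, frame₁, inv_add_mul_I h] <;> ring_nf <;> simp [Complex.I_sq] <;> ring
  refine szoke_image_eq_orbit frame₁ ?_ ?_ ?_ (fun c s h v => ⟨v, rfl, rfl, hrot c s h v⟩)
    (fun c s h v => ⟨v, rfl, rfl, hrot c s h v⟩) u c
  · rintro _ ⟨x₁, x₃, x₅, ξ₂, ξ₄, ξ₆, h, rfl⟩
    obtain ⟨P, R, hPR, hz⟩ := szoke_eq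
      ((![x₁, 0, x₃, 0, x₅, 0], ![0, ξ₂, 0, ξ₄, 0, ξ₆]) : (Fin 6 → ℝ) × (Fin 6 → ℝ))
    -- These are `z₀ ± √-1 z₁` and its analogues: the even-indexed entries of `z` are real and the
    -- odd-indexed ones imaginary, so the coordinates are real.
    refine ⟨![P * x₁ - R * ξ₂, P * x₁ + R * ξ₂, P * x₃ - R * ξ₄, P * x₃ + R * ξ₄,
      P * x₅ - R * ξ₆, P * x₅ + R * ξ₆], ?_, ?_⟩
    · change (P * x₁ - R * ξ₂) * (P * x₁ + R * ξ₂) + ((P * x₃ - R * ξ₄) * (P * x₃ + R * ξ₄) +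
        (P * x₅ - R * ξ₆) * (P * x₅ + R * ξ₆)) = 1
      simp [dotProduct, Fin.sum_univ_six] at hPR
      linear_combination hPR + P ^ 2 * h
    · rw [hz]
      change _ = basis₁.mulVec _
      rw [basis₁_mulVec]
      funext i
      fin_cases i <;> simp <;> ring
  · intro v hv
    have hv' : v 0 * v 1 + (v 2 * v 3 + v 4 * v 5) = 1 := hv
    obtain ⟨α, β, h1, h2⟩ := exists_szoke_eq (n := 5)
      (p := ![(v 0 + v 1) / 2, 0, (v 2 + v 3) / 2, 0, (v 4 + v 5) / 2, 0])
      (q := ![0, (v 1 - v 0) / 2, 0, (v 3 - v 2) / 2, 0, (v 5 - v 4) / 2]) (by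
        simp [dotProduct, Fin.sum_univ_six]
        linear_combination hv')
    refine ⟨_, ⟨α * ((v 0 + v 1) / 2), α * ((v 2 + v 3) / 2), α * ((v 4 + v 5) / 2),
      β * ((v 1 - v 0) / 2), β * ((v 3 - v 2) / 2), β * ((v 5 - v 4) / 2), ?_, ?_⟩, h2.trans ?_⟩
    · simp [dotProduct, Fin.sum_univ_six] at h1
      linear_combination h1
    · simp
    · change _ = basis₁.mulVec _
      rw [basis₁_mulVec]
      funext i
      fin_cases i <;> simp <;> ring
  · intro v
    change rotationPairing (basis₁.mulVec _) = _
    rw [basis₁_mulVec]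
    simp [rotationPairing, frame₁, Fin.sum_univ_six]
    ring

theorem szoke_image_orbit₂ (u : ℝ → ℝ) (c : Module.Dual ℝ hopfLieAlgebra) :
    szoke '' hopfOrbit (levelSet u L₂ c) = frame₂.orbit u (c hopfGenerator) := by
  -- The last two coordinates have weight `0` in the frame; the real rotation that the circle
  -- performs on them is absorbed into the real vector.
  have hrot (c s : ℝ) (h : c ^ 2 + s ^ 2 = 1) (v : Fin 6 → ℝ) :
      rot (c : ℂ) s (frame₂.B.mulVec fun l => (v l : ℂ)) =
        frame₂.B.mulVec fun l => ((c : ℂ) + s * Complex.I) ^ frame₂.n l *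
          ((![v 0, v 1, v 2, v 3, c * v 4 - s * v 5, s * v 4 + c * v 5] : Fin 6 → ℝ) l : ℂ) := by
    change rot (c : ℂ) s (basis₂.mulVec _) = basis₂.mulVec _
    rw [basis₂_mulVec, basis₂_mulVec]
    funext i
    fin_cases i <;> simp [rot, frame₂, inv_add_mul_I h] <;> ring_nf <;> simp [Complex.I_sq] <;> ring
  have hQ (c s : ℝ) (h : c ^ 2 + s ^ 2 = 1) (v : Fin 6 → ℝ) :
      v 0 * v 1 + (v 2 * v 3 - ((c * v 4 - s * v 5) * (c * v 4 - s * v 5) +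
        (s * v 4 + c * v 5) * (s * v 4 + c * v 5))) =
      v 0 * v 1 + (v 2 * v 3 - (v 4 * v 4 + v 5 * v 5)) := by
    linear_combination -(v 4 * v 4 + v 5 * v 5) * h
  have hsum (v : Fin 6 → ℝ) (x y : ℝ) :
      ∑ l, frame₂.d l * (frame₂.n l * (![v 0, v 1, v 2, v 3, x, y] : Fin 6 → ℝ) l ^ 2) =
        ∑ l, frame₂.d l * (frame₂.n l * v l ^ 2) := by
    simp [frame₂, Fin.sum_univ_six]
  refine szoke_image_eq_orbit frame₂ ?_ ?_ ?_
    (fun c s h v => ⟨_, hQ c s h v, hsum v _ _, hrot c s h v⟩) (fun c s h w => ?_) u c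
  · rintro _ ⟨x₁, x₃, ξ₂, ξ₄, ξ₅, ξ₆, h, rfl⟩
    obtain ⟨P, R, hPR, hz⟩ := szoke_eq
      ((![x₁, 0, x₃, 0, 0, 0], ![0, ξ₂, 0, ξ₄, ξ₅, ξ₆]) : (Fin 6 → ℝ) × (Fin 6 → ℝ))
    refine ⟨![P * x₁ - R * ξ₂, P * x₁ + R * ξ₂, P * x₃ - R * ξ₄, P * x₃ + R * ξ₄,
      R * ξ₅, R * ξ₆], ?_, ?_⟩
    · change (P * x₁ - R * ξ₂) * (P * x₁ + R * ξ₂) + ((P * x₃ - R * ξ₄) * (P * x₃ + R * ξ₄) -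
        (R * ξ₅ * (R * ξ₅) + R * ξ₆ * (R * ξ₆))) = 1
      simp [dotProduct, Fin.sum_univ_six] at hPR
      linear_combination hPR + P ^ 2 * h
    · rw [hz]
      change _ = basis₂.mulVec _
      rw [basis₂_mulVec]
      funext i
      fin_cases i <;> simp <;> ring
  · intro v hv
    have hv' : v 0 * v 1 + (v 2 * v 3 - (v 4 * v 4 + v 5 * v 5)) = 1 := hv
    obtain ⟨α, β, h1, h2⟩ := exists_szoke_eq (n := 5)
      (p := ![(v 0 + v 1) / 2, 0, (v 2 + v 3) / 2, 0, 0, 0])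
      (q := ![0, (v 1 - v 0) / 2, 0, (v 3 - v 2) / 2, v 4, v 5]) (by
        simp [dotProduct, Fin.sum_univ_six]
        linear_combination hv')
    refine ⟨_, ⟨α * ((v 0 + v 1) / 2), α * ((v 2 + v 3) / 2),
      β * ((v 1 - v 0) / 2), β * ((v 3 - v 2) / 2), β * v 4, β * v 5, ?_, ?_⟩, h2.trans ?_⟩
    · simp [dotProduct, Fin.sum_univ_six] at h1
      linear_combination h1
    · simp
    · change _ = basis₂.mulVec _
      rw [basis₂_mulVec]
      funext i
      fin_cases i <;> simp <;> ring
  · intro v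
    change rotationPairing (basis₂.mulVec _) = _
    rw [basis₂_mulVec]
    simp [rotationPairing, frame₂, Fin.sum_univ_six]
    ring
  -- The inverse rotation of the last two coordinates.
  · set v : Fin 6 → ℝ := ![w 0, w 1, w 2, w 3, c * w 4 + s * w 5, -s * w 4 + c * w 5] with hv
    have hw : (![v 0, v 1, v 2, v 3, c * v 4 - s * v 5, s * v 4 + c * v 5] : Fin 6 → ℝ) = w := by
      funext i
      fin_cases i <;> simp [hv]
      · linear_combination w 4 * h
      · linear_combination w 5 * h
    refine ⟨v, ?_, hsum w _ _, ?_⟩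
    · change w 0 * w 1 + (w 2 * w 3 - ((c * w 4 + s * w 5) * (c * w 4 + s * w 5) +
        (-s * w 4 + c * w 5) * (-s * w 4 + c * w 5))) =
        w 0 * w 1 + (w 2 * w 3 - (w 4 * w 4 + w 5 * w 5))
      linear_combination -(w 4 * w 4 + w 5 * w 5) * h
    · rw [hrot c s h, hw]

/-! ### Assembly -/

theorem isSpecialLagrangian_of_charts {a : ℝ} {u : ℝ → ℝ} (hu : IsPotential 5 a u) {lam : ℂ}
    (hlam : ‖lam‖ ^ 2 = 2 ^ 5 * a) {V : Set ((Fin 6 → ℝ) × (Fin 6 → ℝ))}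
    (hV : V ⊆ cotangentSphere 5) (F : AdaptedFrame) {k : ℝ} {κ : ℂ}
    (h : szoke '' hopfOrbit V = F.orbit u k)
    (hF : ∀ p ∈ F.orbit u k, ∃ W ψ, IsSpecialChart u (F.orbit u k) κ W ψ ∧ p ∈ ψ '' W) :
    IsSpecialLagrangian 5 u lam (hopfOrbit V) := by
  have hq : F.orbit u k ⊆ quadric 5 := fun z hz => hz.1
  refine ⟨hopfOrbit_subset_cotangentSphere hV, ?_, (lam * κ).arg, ?_⟩
  · rw [h]
    exact isLagrangian_of_charts hq hF
  · rw [h]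
    exact hasPhase_of_charts hu hlam hq hF

end Stenzel

end

theorem proposition5p2 (a : ℝ) (u : ℝ → ℝ) (hu : Stenzel.IsPotential 5 a u)
    (lam : ℂ) (hlam : ‖lam‖ ^ 2 = 2 ^ 5 * a)
    (c : Module.Dual ℝ Stenzel.hopfLieAlgebra) :
    ((Stenzel.levelSet u Stenzel.L₁ c).Nonempty →
      Stenzel.IsSpecialLagrangian 5 u lam
        (Stenzel.hopfOrbit (Stenzel.levelSet u Stenzel.L₁ c))) ∧
    ((Stenzel.levelSet u Stenzel.L₂ c).Nonempty →
      Stenzel.IsSpecialLagrangian 5 u lam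
        (Stenzel.hopfOrbit (Stenzel.levelSet u Stenzel.L₂ c))) := by
  refine ⟨fun _ => ?_, fun _ => ?_⟩
  · exact Stenzel.isSpecialLagrangian_of_charts hu hlam
      (fun p hp => Stenzel.L₁_subset_cotangentSphere hp.1) Stenzel.frame₁
      (Stenzel.szoke_image_orbit₁ u c) fun p hp => Stenzel.exists_chart_frame₁ hu hp
  · exact Stenzel.isSpecialLagrangian_of_charts hu hlam
      (fun p hp => Stenzel.L₂_subset_cotangentSphere hp.1) Stenzel.frame₂
      (Stenzel.szoke_image_orbit₂ u c) fun p hp => Stenzel.exists_chart_frame₂ hu hp
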